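/- **Setting.** Let $G$ be a connected undirected graph on the nodes $\{1,\dots,n\}$ with symmetric edge weights $w_{ij}=w_{ji}>0$, and let $L\in\mathbb{R}^{n\times n}$ be its weighted Laplacian: $L_{ij}=-w_{ij}$ if $\{i,j\}$ is an edge, $L_{ii}=\sum_{j\sim i}w_{ij}$, and $L_{ij}=0$ otherwise. Let the local costs $f_i:\mathbb{R}\to\mathbb{R}$ be strongly convex and quadratic, $f_i(x)=\tfrac12 a_ix^2+b_ix$, and let $f(x)=\sum_i f_i(x_i)$ with (constant, diagonal) Hessian $H=\nabla_{xx}f$. Let $d\in\mathbb{R}$, $\underline{x},\overline{x}\in\mathbb{R}^n$, and let $x^0\in\mathbb{R}^n$ satisfy $\sum_i x^0_i=d$. Put $g(z)=f(x^0+Lz)$ and $$P(z)=\begin{bmatrix}\underline{x}-x^0-Lz\\ x^0+Lz-\overline{x}\end{bmatrix}\in\mathbb{R}^{2n},\qquad \mathcal{L}(z,\lambda)=g(z)+\lambda^\top P(z),$$ and let $\mathcal{P}2$ be the problem of minimizing $g(z)$ over $z\in\mathbb{R}^n$ subject to $P(z)\preceq 0$ (componentwise). Let $T\in\mathbb{R}^{n\times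 n}$ be the orthogonal matrix whose last column is $\tfrac{1}{\sqrt n}\mathbf{1}$ and whose $j$-th column, for $j<n$, is $\big(n(n+1+2\sqrt n)\big)^{-1/2}$ times the vector with $j$-th entry $n-1+\sqrt n$, last entry $-1-\sqrt n$, and all other entries $-1$. Let $J=[\,I_{n-1}\ \ 0\,]\in\mathbb{R}^{(n-1)\times n}$ and $M=JT^\top LHLTJ^\top$. Let $q\in\{0,1,2,\dots\}$ and $A_q=\sum_{p=0}^{q}(I_n-LHL)^p$. Assume that 1. (convergent eigenvalues) there is $\varepsilon<1$ with $-\varepsilon I_{n-1}\preceq I_{n-1}-M\preceq\varepsilon I_{n-1}$ in the order of symmetric matrices; 2. (Slater condition) there is $y\in\mathbb{R}^n$ with all entries of $P(y)$ strictly negative. **Theorem.** Let $(z,\lambda):[0,\infty)\to\mathbb{R}^n\times\mathbb{R}^{2n}$ be any solution (locally absolutely continuous, satisfying the equations for almost every $t\ge 0$) of $$\dot z=-A_q\nabla_z\mathcal{L}(z,\lambda),\qquad \dot\lambda=[P(z)]^+_\lambda,$$ with $\lambda(0)\succeq 0$, where $[u]^+_v$ is taken componentwise and equals $u$ if $v>0$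 and $\max\{0,u\}$ if $v\le 0$. Then there is a unique optimizer $z^\star$ of $\mathcal{P}2$ with $\mathbf{1}^\top z^\star=\mathbf{1}^\top z(0)$, and there is $\lambda^\star\succeq 0$ such that $(z^\star,\lambda^\star)$ is a saddle point of $\mathcal{L}$, that is, $$\mathcal{L}(z^\star,\lambda)\le\mathcal{L}(z^\star,\lambda^\star)\le\mathcal{L}(z,\lambda^\star)\qquad\text{for all } z\in\mathbb{R}^n,\ \lambda\in\mathbb{R}^{2n}_{\ge 0},$$ and $(z(t),\lambda(t))\to(z^\star,\lambda^\star)$ as $t\to\infty$. -/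

import Mathlib

open Matrix

noncomputable section

namespace DANA

/-- The weighted Laplacian of the graph `G` with edge weights `w`: the entry is `-w i j` on an
edge, the total incident weight on the diagonal, and `0` otherwise. -/
def weightedLaplacian {n : ℕ} (G : SimpleGraph (Fin n)) [DecidableRel G.Adj]
    (w : Fin n → Fin n → ℝ) : Matrix (Fin n) (Fin n) ℝ :=
  Matrix.of fun i j =>
    if i = j then ∑ k ∈ G.neighborFinset i, w i k
    else if G.Adj i j then -w i j
    else 0

/-- A local cost that is strongly convex and quadratic, `x ↦ a x² / 2 + b x`. -/
def IsQuadraticCost (φ : ℝ → ℝ) : Prop :=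
  (∃ m : ℝ, 0 < m ∧ StrongConvexOn Set.univ m φ) ∧
    ∃ a b : ℝ, ∀ x : ℝ, φ x = 1 / 2 * a * x ^ 2 + b * x

/-- The allocation `x⁰ + L z`. -/
def alloc {n : ℕ} (L : Matrix (Fin n) (Fin n) ℝ) (x0 z : EuclideanSpace ℝ (Fin n)) :
    EuclideanSpace ℝ (Fin n) :=
  x0 + Matrix.toEuclideanLin L z

/-- The reduced cost `g z = f (x⁰ + L z) = ∑ i, f i (x⁰ i + L i z)`. -/
def reducedCost {n : ℕ} (f : Fin n → ℝ → ℝ) (L : Matrix (Fin n) (Fin n) ℝ)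
    (x0 z : EuclideanSpace ℝ (Fin n)) : ℝ :=
  ∑ i, f i (alloc L x0 z i)

/-- The stacked constraint function `P z = (xlo - x⁰ - L z, x⁰ + L z - xhi)` in `ℝ²ⁿ`. -/
def boxConstraint {n : ℕ} (L : Matrix (Fin n) (Fin n) ℝ)
    (x0 xlo xhi z : EuclideanSpace ℝ (Fin n)) : EuclideanSpace ℝ (Fin n ⊕ Fin n) :=
  WithLp.toLp 2 (Sum.elim (fun i => xlo i - alloc L x0 z i) (fun i => alloc L x0 z i - xhi i))

/-- The feasible set `{z | P z ≤ 0}` of the box-constrained problem. -/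
def feasibleSet {n : ℕ} (L : Matrix (Fin n) (Fin n) ℝ)
    (x0 xlo xhi : EuclideanSpace ℝ (Fin n)) : Set (EuclideanSpace ℝ (Fin n)) :=
  {z | ∀ k, boxConstraint L x0 xlo xhi z k ≤ 0}

/-- `z` is an optimizer of the box-constrained problem: minimize `g z` subject to `P z ≤ 0`. -/
def IsOptimizer {n : ℕ} (f : Fin n → ℝ → ℝ) (L : Matrix (Fin n) (Fin n) ℝ)
    (x0 xlo xhi z : EuclideanSpace ℝ (Fin n)) : Prop :=
  z ∈ feasibleSet L x0 xlo xhi ∧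
    ∀ z' ∈ feasibleSet L x0 xlo xhi, reducedCost f L x0 z ≤ reducedCost f L x0 z'

/-- The Lagrangian `g z + λᵀ P z` of the box-constrained problem. -/
def lagrangian {n : ℕ} (f : Fin n → ℝ → ℝ) (L : Matrix (Fin n) (Fin n) ℝ)
    (x0 xlo xhi z : EuclideanSpace ℝ (Fin n)) (lam : EuclideanSpace ℝ (Fin n ⊕ Fin n)) : ℝ :=
  reducedCost f L x0 z + ∑ k, lam k * boxConstraint L x0 xlo xhi z k

/-- `(zs, ls)` is a saddle point of the Lagrangian on `ℝⁿ × ℝ²ⁿ_{≥ 0}`. -/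
def IsSaddlePoint {n : ℕ} (f : Fin n → ℝ → ℝ) (L : Matrix (Fin n) (Fin n) ℝ)
    (x0 xlo xhi zs : EuclideanSpace ℝ (Fin n)) (ls : EuclideanSpace ℝ (Fin n ⊕ Fin n)) : Prop :=
  (∀ k, 0 ≤ ls k) ∧
    (∀ lam : EuclideanSpace ℝ (Fin n ⊕ Fin n), (∀ k, 0 ≤ lam k) →
      lagrangian f L x0 xlo xhi zs lam ≤ lagrangian f L x0 xlo xhi zs ls) ∧
    ∀ z : EuclideanSpace ℝ (Fin n),
      lagrangian f L x0 xlo xhi zs ls ≤ lagrangian f L x0 xlo xhi z ls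

/-- The Hessian `H x` of the separable cost `∑ i, f i (x i)`, a diagonal matrix. -/
def hessian {n : ℕ} (f : Fin n → ℝ → ℝ) (x : EuclideanSpace ℝ (Fin n)) :
    Matrix (Fin n) (Fin n) ℝ :=
  Matrix.diagonal fun i => iteratedDeriv 2 (f i) (x i)

/-- The orthogonal matrix `T` of the change of coordinates. Its last column is `1 / √n`; the
other columns span the orthogonal complement of the all-ones vector. -/
def coordT (n : ℕ) : Matrix (Fin n) (Fin n) ℝ :=
  Matrix.of fun i j =>
    if (j : ℕ) + 1 = n then 1 / √(n : ℝ)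
    else
      (√((n : ℝ) * (n + 1 + 2 * √(n : ℝ))))⁻¹ *
        (if (i : ℕ) + 1 = n then -1 - √(n : ℝ)
          else if i = j then (n : ℝ) - 1 + √(n : ℝ)
          else -1)

/-- The `(n - 1) × n` matrix `J = [I 0]`. -/
def projJ (n : ℕ) : Matrix (Fin (n - 1)) (Fin n) ℝ :=
  Matrix.of fun i j => if (i : ℕ) = (j : ℕ) then 1 else 0

/-- The reduced Hessian `M x = J Tᵀ L (H x) L T Jᵀ`, of size `(n - 1) × (n - 1)`. -/
def reducedHessian {n : ℕ} (f : Fin n → ℝ → ℝ) (L : Matrix (Fin n) (Fin n) ℝ)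
    (x : EuclideanSpace ℝ (Fin n)) : Matrix (Fin (n - 1)) (Fin (n - 1)) ℝ :=
  projJ n * (coordT n)ᵀ * L * hessian f x * L * coordT n * (projJ n)ᵀ

/-- Convergent eigenvalues: there is `ε < 1` such that `-ε I ≼ I - M x ≼ ε I` for all `x`, in the
Loewner order. -/
def ConvergentEigenvalues {n : ℕ} (f : Fin n → ℝ → ℝ) (L : Matrix (Fin n) (Fin n) ℝ) : Prop :=
  ∃ ε : ℝ, ε < 1 ∧ ∀ x : EuclideanSpace ℝ (Fin n),
    ((1 - reducedHessian f L x) - (-(ε • (1 : Matrix (Fin (n - 1)) (Fin (n - 1)) ℝ)))).PosSemidef ∧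
    (ε • (1 : Matrix (Fin (n - 1)) (Fin (n - 1)) ℝ) - (1 - reducedHessian f L x)).PosSemidef

/-- The approximate Newton weighting `A_q z = ∑_{p=0}^{q} (I - L H(x⁰ + L z) L)^p`. -/
def approxInv {n : ℕ} (f : Fin n → ℝ → ℝ) (L : Matrix (Fin n) (Fin n) ℝ)
    (x0 : EuclideanSpace ℝ (Fin n)) (q : ℕ) (z : EuclideanSpace ℝ (Fin n)) :
    Matrix (Fin n) (Fin n) ℝ :=
  ∑ p ∈ Finset.range (q + 1), (1 - L * hessian f (alloc L x0 z) * L) ^ p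

/-- The projection `[u]⁺_v`: it is `u` if `v > 0`, and `max 0 u` if `v ≤ 0`. -/
def posProj (u v : ℝ) : ℝ :=
  if 0 < v then u else max 0 u

/-- The primal component `-A_q ∇_z ℒ(z, λ)` of the dynamics. -/
def primalField {n : ℕ} (f : Fin n → ℝ → ℝ) (L : Matrix (Fin n) (Fin n) ℝ)
    (x0 xlo xhi : EuclideanSpace ℝ (Fin n)) (q : ℕ)
    (z : EuclideanSpace ℝ (Fin n)) (lam : EuclideanSpace ℝ (Fin n ⊕ Fin n)) :
    EuclideanSpace ℝ (Fin n) :=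
  -Matrix.toEuclideanLin (approxInv f L x0 q z)
    (gradient (fun y => lagrangian f L x0 xlo xhi y lam) z)

/-- The dual component `[∇_λ ℒ(z, λ)]⁺_λ = [P z]⁺_λ` of the dynamics, taken componentwise. -/
def dualField {n : ℕ} (L : Matrix (Fin n) (Fin n) ℝ)
    (x0 xlo xhi : EuclideanSpace ℝ (Fin n))
    (z : EuclideanSpace ℝ (Fin n)) (lam : EuclideanSpace ℝ (Fin n ⊕ Fin n)) :
    EuclideanSpace ℝ (Fin n ⊕ Fin n) :=
  WithLp.toLp 2 fun k => posProj (boxConstraint L x0 xlo xhi z k) (lam k)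

/-- `(z, lam)` is a (Carathéodory) solution on `[0, ∞)` of the projected primal-dual dynamics: it
is locally absolutely continuous and satisfies the differential equation at almost every time.
The right-hand side is discontinuous in `lam`, so no everywhere differentiable solution exists
in general. -/
def IsTrajectory {n : ℕ} (f : Fin n → ℝ → ℝ) (L : Matrix (Fin n) (Fin n) ℝ)
    (x0 xlo xhi : EuclideanSpace ℝ (Fin n)) (q : ℕ)
    (z : ℝ → EuclideanSpace ℝ (Fin n)) (lam : ℝ → EuclideanSpace ℝ (Fin n ⊕ Fin n)) : Prop :=
  (∀ b : ℝ, 0 ≤ b →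
    AbsolutelyContinuousOnInterval z 0 b ∧ AbsolutelyContinuousOnInterval lam 0 b) ∧
  ∀ᵐ t ∂(MeasureTheory.volume.restrict (Set.Ici (0 : ℝ))),
    HasDerivAt z (primalField f L x0 xlo xhi q (z t) (lam t)) t ∧
    HasDerivAt lam (dualField L x0 xlo xhi (z t) (lam t)) t

end DANA

end

/-! Quadratic costs make all data constant. With `Q = L * H * L`, with `B` stacking `-L` and `L`,
and with `A` the truncated Neumann sum, the dynamics is a weighted primal-dual flow of a convex
quadratic program. The all-ones vector is annihilated by `Q` and `B` and is a left eigenvector of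
`A`, so the sum of the entries of `z` is conserved and `z - zs` stays orthogonal to it. On that
complement the eigenvalue condition places the form of `Q` between `1 - ε` and `1 + ε`: the upper
bound makes `A` positive definite (`posDef_two_sub`, `posDef_sum_range_pow`), the lower one makes
`Q` coercive along `z - zs`.

The function V = ½ (z - zs)ᵀ A⁻¹ (z - zs) + ½ |λ - ls|² then decreases at least at the rate W = (z -
zs)ᵀ Q (z - zs) - λᵀ P(zs), a sum of two nonnegative terms. The dual velocity jumps, but W is
continuous, hence uniformly continuous along the bounded trajectory. A Barbalat argument therefore
replaces an invariance principle: W tends to 0, so `z` tends to `zs`. The same argument on the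
coordinates of `z` sends the gradient to 0. Limit points of λ are thus multipliers; V recentred at
one of them is monotone and vanishes along a subsequence, so λ itself converges (`tendsto_isKKT`).

The point `zs` comes from compactness of the feasible slice (`exists_optimum_on_slice`), its
multiplier from separation under Slater's condition (`exists_isKKT`). -/

noncomputable section

open Set Filter Topology MeasureTheory

/-! ### Calculus of absolutely continuous functions. -/

namespace AbsolutelyContinuousOnInterval

variable {ι : Type*} [Fintype ι]

theorem sub_le_of_ae_hasDerivAt_le {φ φ' : ℝ → ℝ} {a b C : ℝ} (hab : a ≤ b)
    (hac : AbsolutelyContinuousOnInterval φ a b)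
    (h : ∀ᵐ t : ℝ, t ∈ Ioc a b → HasDerivAt φ (φ' t) t ∧ φ' t ≤ C) :
    φ b - φ a ≤ C * (b - a) := by
  rw [← hac.integral_deriv_eq_sub]
  have hc : ∫ _ in a..b, C = C * (b - a) := by simp [mul_comm]
  rw [← hc]
  refine intervalIntegral.integral_mono_ae_restrict hab hac.intervalIntegrable_deriv (by simp) ?_
  rw [← Measure.restrict_congr_set (Ioc_ae_eq_Icc (α := ℝ) (μ := volume)), EventuallyLE,
    ae_restrict_iff' measurableSet_Ioc]
  filter_upwards [h] with t ht hmem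
  rw [(ht hmem).1.deriv]
  exact (ht hmem).2

theorem const' (c a b : ℝ) : AbsolutelyContinuousOnInterval (fun _ : ℝ => c) a b := by
  simpa using (LipschitzWith.const c (α := ℝ)).lipschitzOnWith.absolutelyContinuousOnInterval
    (a := a) (b := b)

theorem finset_sum {κ : Type*} (s : Finset κ) {f : κ → ℝ → ℝ} {a b : ℝ}
    (hf : ∀ i ∈ s, AbsolutelyContinuousOnInterval (f i) a b) :
    AbsolutelyContinuousOnInterval (fun t => ∑ i ∈ s, f i t) a b := by
  classical
  induction s using Finset.induction_on with
  | empty => simpa using const' 0 a b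
  | insert i s hi ih =>
    simp only [Finset.sum_insert hi]
    exact (hf i (by simp)).fun_add (ih fun j hj => hf j (by simp [hj]))

theorem dotProduct {u v : ℝ → ι → ℝ} {a b : ℝ}
    (hu : ∀ i, AbsolutelyContinuousOnInterval (fun t => u t i) a b)
    (hv : ∀ i, AbsolutelyContinuousOnInterval (fun t => v t i) a b) :
    AbsolutelyContinuousOnInterval (fun t => u t ⬝ᵥ v t) a b :=
  finset_sum _ fun i _ => (hu i).fun_mul (hv i)

theorem mulVec {κ : Type*} (N : Matrix κ ι ℝ) {u : ℝ → ι → ℝ} {a b : ℝ}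
    (hu : ∀ i, AbsolutelyContinuousOnInterval (fun t => u t i) a b) (k : κ) :
    AbsolutelyContinuousOnInterval (fun t => (N *ᵥ u t) k) a b :=
  finset_sum _ fun i _ => (hu i).const_mul _

theorem euclidean_apply {u : ℝ → EuclideanSpace ℝ ι} {a b : ℝ}
    (hu : AbsolutelyContinuousOnInterval u a b) (i : ι) :
    AbsolutelyContinuousOnInterval (fun t => u t i) a b := by
  refine squeeze_zero (fun t => Finset.sum_nonneg fun _ _ => dist_nonneg) (fun t => ?_) hu
  gcongr with j
  rw [dist_eq_norm, dist_eq_norm, ← PiLp.sub_apply]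
  exact PiLp.norm_apply_le _ i

end AbsolutelyContinuousOnInterval

theorem HasDerivAt.dotProduct' {ι : Type*} [Fintype ι] {u v : ℝ → ι → ℝ} {u' v' : ι → ℝ} {t : ℝ}
    (hu : HasDerivAt u u' t) (hv : HasDerivAt v v' t) :
    HasDerivAt (fun s => u s ⬝ᵥ v s) (u' ⬝ᵥ v t + u t ⬝ᵥ v') t := by
  rw [hasDerivAt_pi] at hu hv
  have := HasDerivAt.fun_sum (u := Finset.univ) fun i _ => (hu i).mul (hv i)
  simpa [_root_.dotProduct, Finset.sum_add_distrib] using this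

theorem HasDerivAt.mulVec' {ι κ : Type*} [Fintype ι] [Fintype κ] (N : Matrix κ ι ℝ)
    {u : ℝ → ι → ℝ} {u' : ι → ℝ} {t : ℝ} (hu : HasDerivAt u u' t) :
    HasDerivAt (fun s => N *ᵥ u s) (N *ᵥ u') t := by
  rw [hasDerivAt_pi] at hu ⊢
  intro k
  exact HasDerivAt.fun_sum (u := Finset.univ) fun i _ => (hu i).const_mul (N k i)

/-! ### Differential inequalities holding almost everywhere. -/

theorem antitoneOn_of_ae_hasDerivAt_nonpos {φ φ' : ℝ → ℝ}
    (hac : ∀ b, 0 ≤ b → AbsolutelyContinuousOnInterval φ 0 b)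
    (h : ∀ᵐ t : ℝ, 0 ≤ t → HasDerivAt φ (φ' t) t ∧ φ' t ≤ 0) : AntitoneOn φ (Ici 0) := by
  intro a ha b hb hab
  have hb' : (0 : ℝ) ≤ b := hb
  have ha' : (0 : ℝ) ≤ a := ha
  have := AbsolutelyContinuousOnInterval.sub_le_of_ae_hasDerivAt_le (φ' := φ') (C := 0) hab
    ((hac b hb).mono (by rw [uIcc_of_le hab, uIcc_of_le hb']; exact Icc_subset_Icc_left ha)) (by
      filter_upwards [h] with t ht hmem
      exact ht (ha'.trans hmem.1.le))
  linarith

theorem abs_sub_le_of_ae_hasDerivAt_bounded {φ φ' : ℝ → ℝ} {C : ℝ}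
    (hac : ∀ b, 0 ≤ b → AbsolutelyContinuousOnInterval φ 0 b)
    (h : ∀ᵐ t : ℝ, 0 ≤ t → HasDerivAt φ (φ' t) t ∧ |φ' t| ≤ C) {a b : ℝ} (ha : 0 ≤ a)
    (hab : a ≤ b) : |φ b - φ a| ≤ C * (b - a) := by
  have hac' : AbsolutelyContinuousOnInterval φ a b :=
    (hac b (ha.trans hab)).mono
      (by rw [uIcc_of_le hab, uIcc_of_le (ha.trans hab)]; exact Icc_subset_Icc_left ha)
  rw [abs_le]
  constructor
  · have := AbsolutelyContinuousOnInterval.sub_le_of_ae_hasDerivAt_le (φ' := fun t => -φ' t)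
      (C := C) hab hac'.neg (by
        filter_upwards [h] with t ht hmem
        have := ht (ha.trans hmem.1.le)
        exact ⟨this.1.neg, (neg_le_abs _).trans this.2⟩)
    simp only [Pi.neg_apply] at this
    linarith
  · exact AbsolutelyContinuousOnInterval.sub_le_of_ae_hasDerivAt_le (φ' := φ') hab hac' (by
      filter_upwards [h] with t ht hmem
      have := ht (ha.trans hmem.1.le)
      exact ⟨this.1, (le_abs_self _).trans this.2⟩)

/-- A one-sided Barbalat lemma: a convergent function cannot decrease at a uniformly continuous
rate `h` that is repeatedly bounded away from `0`. -/
theorem eventually_lt_of_tendsto_of_ae_hasDerivAt_le {φ φ' h : ℝ → ℝ} {l δ : ℝ}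
    (hac : ∀ b, 0 ≤ b → AbsolutelyContinuousOnInterval φ 0 b)
    (hder : ∀ᵐ t : ℝ, 0 ≤ t → HasDerivAt φ (φ' t) t ∧ φ' t ≤ -h t)
    (huc : UniformContinuousOn h (Ici 0)) (hlim : Tendsto φ atTop (𝓝 l)) (hδ : 0 < δ) :
    ∀ᶠ t in atTop, h t < δ := by
  obtain ⟨η, hη, hh⟩ := Metric.uniformContinuousOn_iff.1 huc (δ / 2) (by positivity)
  -- If `h t ≥ δ`, then `h` exceeds `δ / 2` on an interval of length `η / 2`, so `φ` drops by at
  -- least `δ * η / 4`; closeness to the limit allows less than `δ * η / 8`.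
  obtain ⟨N, hN⟩ := Metric.tendsto_atTop.1 hlim (δ * η / 16) (by positivity)
  filter_upwards [eventually_ge_atTop N, eventually_ge_atTop 0] with t htN ht0
  by_contra! hcon
  have h1 := hN t htN
  have h2 := hN (t + η / 2) (by linarith)
  rw [Real.dist_eq, abs_lt] at h1 h2
  have hle : t ≤ t + η / 2 := by linarith
  have := AbsolutelyContinuousOnInterval.sub_le_of_ae_hasDerivAt_le (φ' := φ') (C := -(δ / 2)) hle
    ((hac (t + η / 2) (by linarith)).mono
      (by rw [uIcc_of_le hle, uIcc_of_le (ht0.trans hle)]; exact Icc_subset_Icc_left ht0)) (by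
      filter_upwards [hder] with s hs hmem
      have hs0 : 0 ≤ s := ht0.trans hmem.1.le
      refine ⟨(hs hs0).1, (hs hs0).2.trans ?_⟩
      have := hh s hs0 t ht0 (by rw [Real.dist_eq, abs_lt]; constructor <;> linarith [hmem.1, hmem.2])
      rw [Real.dist_eq, abs_lt] at this
      linarith)
  nlinarith [mul_pos hδ hη]

/-- After the last time at which `φ` is nonnegative it would be negative, hence nondecreasing, and
could not have gone below zero. -/
theorem nonneg_of_ae_hasDerivAt_nonneg_of_neg {φ φ' : ℝ → ℝ}
    (hac : ∀ b, 0 ≤ b → AbsolutelyContinuousOnInterval φ 0 b)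
    (hder : ∀ᵐ t : ℝ, 0 ≤ t → HasDerivAt φ (φ' t) t ∧ (φ t < 0 → 0 ≤ φ' t))
    (h0 : 0 ≤ φ 0) {t : ℝ} (ht : 0 ≤ t) : 0 ≤ φ t := by
  by_contra! hneg
  have hcont : ContinuousOn φ (Icc 0 t) := by
    simpa [uIcc_of_le ht] using (hac t ht).continuousOn
  set S := {s | s ∈ Icc 0 t ∧ 0 ≤ φ s} with hS
  have hSc : IsCompact S := by
    have : IsClosed S := hcont.preimage_isClosed_of_isClosed isClosed_Icc isClosed_Ici
    exact isCompact_Icc.of_isClosed_subset this fun s hs => hs.1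
  obtain ⟨s, hsS, hsmax⟩ := hSc.exists_isGreatest ⟨0, ⟨le_rfl, ht⟩, h0⟩
  have := AbsolutelyContinuousOnInterval.sub_le_of_ae_hasDerivAt_le (φ' := fun t => -φ' t)
    (C := 0) hsS.1.2
    ((hac t ht).mono (by
      rw [uIcc_of_le hsS.1.2, uIcc_of_le ht]; exact Icc_subset_Icc_left hsS.1.1)).neg (by
      filter_upwards [hder] with r hr hmem
      have hr0 : 0 ≤ r := hsS.1.1.trans hmem.1.le
      refine ⟨(hr hr0).1.neg, ?_⟩
      have : φ r < 0 := by
        by_contra! hge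
        exact absurd (hsmax ⟨⟨hr0, hmem.2⟩, hge⟩) (not_le.2 hmem.1)
      linarith [(hr hr0).2 this])
  simp only [Pi.neg_apply] at this
  linarith [hsS.2]

/-! ### Quadratic programs and their projected primal-dual flow. -/

/-- The Karush-Kuhn-Tucker conditions of the quadratic program: minimize
`z ⬝ᵥ Q *ᵥ z / 2 + g ⬝ᵥ z` subject to `c + B *ᵥ z ≤ 0`. -/
structure IsKKT {ι κ : Type*} [Fintype ι] [Fintype κ] (Q : Matrix ι ι ℝ) (B : Matrix κ ι ℝ)
    (g : ι → ℝ) (c : κ → ℝ) (zs : ι → ℝ) (ls : κ → ℝ) : Prop where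
  stationary : Q *ᵥ zs + g + Bᵀ *ᵥ ls = 0
  feasible : ∀ k, (c + B *ᵥ zs) k ≤ 0
  nonneg : ∀ k, 0 ≤ ls k
  slack : ls ⬝ᵥ (c + B *ᵥ zs) = 0

/-- A solution on `[0, ∞)` of the projected primal-dual dynamics of a quadratic program. -/
structure IsPrimalDualFlow {ι κ : Type*} [Fintype ι] [Fintype κ] (A Q : Matrix ι ι ℝ)
    (B : Matrix κ ι ℝ) (g : ι → ℝ) (c : κ → ℝ) (z : ℝ → ι → ℝ) (l : ℝ → κ → ℝ) : Prop where
  ac_primal : ∀ i b, 0 ≤ b → AbsolutelyContinuousOnInterval (fun t => z t i) 0 b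
  ac_dual : ∀ k b, 0 ≤ b → AbsolutelyContinuousOnInterval (fun t => l t k) 0 b
  hasDerivAt : ∀ᵐ t : ℝ, 0 ≤ t →
    HasDerivAt z (-(A *ᵥ (Q *ᵥ z t + g + Bᵀ *ᵥ l t))) t ∧
    HasDerivAt l (fun k => DANA.posProj ((c + B *ᵥ z t) k) (l t k)) t

theorem DANA.abs_posProj_le (u v : ℝ) : |DANA.posProj u v| ≤ |u| := by
  unfold DANA.posProj
  split_ifs
  · exact le_rfl
  · rw [abs_of_nonneg (le_max_left _ _)]
    exact max_le (abs_nonneg u) (le_abs_self u)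

/-- The projection alters `u` only by raising it when `v ≤ 0`, and then the factor `v - m` is
nonpositive. Dropping the projection thus only weakens the Lyapunov estimate, `m` being a
multiplier. -/
theorem DANA.sub_mul_posProj_le (u v : ℝ) {m : ℝ} (hm : 0 ≤ m) :
    (v - m) * DANA.posProj u v ≤ (v - m) * u := by
  unfold DANA.posProj
  split_ifs with h
  · exact le_rfl
  · exact mul_le_mul_of_nonpos_left (le_max_right _ _) (by linarith)

/-! ### Lyapunov function: derivative and bounds. -/

namespace IsPrimalDualFlow

variable {ι κ : Type*} [Fintype ι] [Fintype κ] {A N Q : Matrix ι ι ℝ} {B : Matrix κ ι ℝ}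
  {g : ι → ℝ} {c : κ → ℝ} {z : ℝ → ι → ℝ} {l : ℝ → κ → ℝ} {zs : ι → ℝ} {ls : κ → ℝ}

theorem dual_nonneg (hf : IsPrimalDualFlow A Q B g c z l) (h0 : ∀ k, 0 ≤ l 0 k) {t : ℝ}
    (ht : 0 ≤ t) (k : κ) : 0 ≤ l t k := by
  refine nonneg_of_ae_hasDerivAt_nonneg_of_neg (φ := fun t => l t k)
    (φ' := fun t => DANA.posProj ((c + B *ᵥ z t) k) (l t k)) (hf.ac_dual k) ?_ (h0 k) ht
  filter_upwards [hf.hasDerivAt] with t hd ht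
  refine ⟨(hasDerivAt_pi.1 (hd ht).2) k, fun hneg => ?_⟩
  simp [DANA.posProj, not_lt.2 hneg.le]

/-- The Lyapunov function of the dynamics; `N` is the inverse of the weighting `A`. -/
def lyapunov (N : Matrix ι ι ℝ) (zs : ι → ℝ) (ls : κ → ℝ) (x : ι → ℝ) (y : κ → ℝ) : ℝ :=
  1 / 2 * ((x - zs) ⬝ᵥ N *ᵥ (x - zs)) + 1 / 2 * ((y - ls) ⬝ᵥ (y - ls))

/-- A lower bound of the rate of decrease of the Lyapunov function. -/
def dissipation (Q : Matrix ι ι ℝ) (B : Matrix κ ι ℝ) (c : κ → ℝ) (zs : ι → ℝ)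
    (x : ι → ℝ) (y : κ → ℝ) : ℝ :=
  (x - zs) ⬝ᵥ Q *ᵥ (x - zs) - y ⬝ᵥ (c + B *ᵥ zs)

theorem lyapunov_ac (hf : IsPrimalDualFlow A Q B g c z l) (N : Matrix ι ι ℝ) (zs : ι → ℝ)
    (ls : κ → ℝ) (b : ℝ) (hb : 0 ≤ b) :
    AbsolutelyContinuousOnInterval (fun t => lyapunov N zs ls (z t) (l t)) 0 b := by
  have hz : ∀ i, AbsolutelyContinuousOnInterval (fun t => (z t - zs) i) 0 b := fun i =>
    (hf.ac_primal i b hb).fun_sub (.const' _ _ _)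
  have hl : ∀ k, AbsolutelyContinuousOnInterval (fun t => (l t - ls) k) 0 b := fun k =>
    (hf.ac_dual k b hb).fun_sub (.const' _ _ _)
  exact ((AbsolutelyContinuousOnInterval.dotProduct hz
    (AbsolutelyContinuousOnInterval.mulVec N hz)).const_mul _).fun_add
    ((AbsolutelyContinuousOnInterval.dotProduct hl hl).const_mul _)

/-- The factor `N` cancels the weighting. Stationarity turns the gradient into `Q *ᵥ (z - zs) + Bᵀ
*ᵥ (l - ls)`, whose second term cancels against the dual contribution, and slackness removes `ls`
from what remains. -/
theorem lyapunov_deriv [DecidableEq ι] (hf : IsPrimalDualFlow A Q B g c z l) (hN : Nᵀ = N)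
    (hNA : N * A = 1) (hk : IsKKT Q B g c zs ls) :
    ∃ V' : ℝ → ℝ, ∀ᵐ t : ℝ, 0 ≤ t →
      HasDerivAt (fun t => lyapunov N zs ls (z t) (l t)) (V' t) t ∧
      V' t ≤ -dissipation Q B c zs (z t) (l t) := by
  refine ⟨fun t => -((z t - zs) ⬝ᵥ (Q *ᵥ z t + g + Bᵀ *ᵥ l t)) +
    (l t - ls) ⬝ᵥ fun k => DANA.posProj ((c + B *ᵥ z t) k) (l t k), ?_⟩
  filter_upwards [hf.hasDerivAt] with t hd ht
  obtain ⟨hz, hl⟩ := hd ht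
  set G := Q *ᵥ z t + g + Bᵀ *ᵥ l t with hG
  have hz' := hz.sub_const zs
  have hl' := hl.sub_const ls
  constructor
  · have h1 := ((hz'.dotProduct' (hz'.mulVec' N)).const_mul (1 / 2)).add
      ((hl'.dotProduct' hl').const_mul (1 / 2))
    refine h1.congr_deriv ?_
    have hNG : N *ᵥ (-(A *ᵥ G)) = -G := by
      rw [mulVec_neg, mulVec_mulVec, hNA, one_mulVec]
    have hsymm : (-(A *ᵥ G)) ⬝ᵥ N *ᵥ (z t - zs) = (z t - zs) ⬝ᵥ (-G) := by
      rw [dotProduct_comm, ← hNG, dotProduct_mulVec, ← mulVec_transpose, hN]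
    rw [hNG, hsymm, dotProduct_neg, dotProduct_comm _ (l t - ls)]
    ring
  · have hG' : G = Q *ᵥ (z t - zs) + Bᵀ *ᵥ (l t - ls) := by
      have : G = G - (Q *ᵥ zs + g + Bᵀ *ᵥ ls) := by rw [hk.stationary, sub_zero]
      rw [this, hG, mulVec_sub, mulVec_sub]
      abel
    have h1 : (l t - ls) ⬝ᵥ (fun k => DANA.posProj ((c + B *ᵥ z t) k) (l t k)) ≤
        (l t - ls) ⬝ᵥ (c + B *ᵥ z t) :=
      Finset.sum_le_sum fun k _ => DANA.sub_mul_posProj_le _ _ (hk.nonneg k)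
    have h2 : (z t - zs) ⬝ᵥ Bᵀ *ᵥ (l t - ls) = (l t - ls) ⬝ᵥ B *ᵥ (z t - zs) := by
      rw [mulVec_transpose, dotProduct_comm, dotProduct_mulVec]
    have h3 : c + B *ᵥ z t = (c + B *ᵥ zs) + B *ᵥ (z t - zs) := by
      rw [mulVec_sub]; abel
    have h4 : (l t - ls) ⬝ᵥ (c + B *ᵥ zs) = l t ⬝ᵥ (c + B *ᵥ zs) := by
      rw [sub_dotProduct, hk.slack, sub_zero]
    rw [h3, dotProduct_add, h4] at h1
    rw [h3] 
    simp only [dissipation]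
    rw [hG', dotProduct_add, h2]
    linarith

theorem tendsto_of_antitoneOn {φ : ℝ → ℝ} (h : AntitoneOn φ (Ici 0)) (hb : ∀ t, 0 ≤ t → 0 ≤ φ t) :
    ∃ a, Tendsto φ atTop (𝓝 a) := by
  have h1 : Antitone fun t => φ (max 0 t) := fun s t hst =>
    h (mem_Ici.2 (le_max_left _ _)) (mem_Ici.2 (le_max_left _ _)) (max_le_max_left 0 hst)
  have h2 : BddBelow (range fun t => φ (max 0 t)) :=
    ⟨0, by rintro _ ⟨t, rfl⟩; exact hb _ (le_max_left _ _)⟩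
  refine ⟨_, (tendsto_atTop_ciInf h1 h2).congr' ?_⟩
  filter_upwards [eventually_ge_atTop 0] with t ht
  rw [max_eq_right ht]

/-- Expand the nonnegative `N`-form at `e - s • A *ᵥ Pi.single i 1` with `s = ±1`. This bounds
coordinates by the Lyapunov function without any eigenvalue estimate for `N`. -/
theorem two_mul_abs_le_of_inverse [DecidableEq ι] (hN : N.PosSemidef) (hNA : N * A = 1)
    (e : ι → ℝ) (i : ι) : 2 * |e i| ≤ e ⬝ᵥ N *ᵥ e + A i i := by
  have hNt : Nᵀ = N := by simpa [Matrix.IsHermitian] using hN.1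
  have key : ∀ s : ℝ, s ^ 2 = 1 → 0 ≤ e ⬝ᵥ N *ᵥ e + A i i - 2 * s * e i := by
    intro s hs
    have h := hN.dotProduct_mulVec_nonneg (e - s • A *ᵥ Pi.single i 1)
    have h1 : N *ᵥ (A *ᵥ Pi.single i 1) = Pi.single i 1 := by
      rw [mulVec_mulVec, hNA, one_mulVec]
    have h2 : (A *ᵥ Pi.single i 1) ⬝ᵥ N *ᵥ e = e i := by
      rw [dotProduct_comm, ← dotProduct_comm, dotProduct_mulVec, ← mulVec_transpose, hNt, h1]
      simp
    simp only [star_trivial, mulVec_sub, mulVec_smul, h1, sub_dotProduct, dotProduct_sub,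
      smul_dotProduct, dotProduct_smul, h2, smul_eq_mul] at h
    simp only [dotProduct_single, mulVec_single, mul_one, MulOpposite.op_one, one_smul, col_apply] at h
    have : s * (s * A i i) = A i i := by rw [← mul_assoc, ← sq, hs, one_mul]
    linarith
  rcases abs_cases (e i) with ⟨h, -⟩ | ⟨h, -⟩
  · linarith [key 1 (by norm_num)]
  · linarith [key (-1) (by norm_num)]

end IsPrimalDualFlow

/-! ### Boundedness and convergence of trajectories. -/

namespace IsPrimalDualFlow

variable {ι κ : Type*} [Fintype ι] [Fintype κ] {A N Q : Matrix ι ι ℝ} {B : Matrix κ ι ℝ}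
  {g : ι → ℝ} {c : κ → ℝ} {z : ℝ → ι → ℝ} {l : ℝ → κ → ℝ} {zs : ι → ℝ} {ls : κ → ℝ}

theorem lyapunov_nonneg (hN : N.PosSemidef) (zs : ι → ℝ) (ls : κ → ℝ) (x : ι → ℝ) (y : κ → ℝ) :
    0 ≤ lyapunov N zs ls x y := by
  have h1 := hN.dotProduct_mulVec_nonneg (x - zs)
  have h2 : 0 ≤ (y - ls) ⬝ᵥ (y - ls) := Finset.sum_nonneg fun i _ => mul_self_nonneg _
  rw [star_trivial] at h1
  unfold lyapunov
  linarith

theorem abs_sub_le_lyapunov_primal [DecidableEq ι] (hN : N.PosSemidef) (hNA : N * A = 1)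
    (zs : ι → ℝ) (ls : κ → ℝ) (x : ι → ℝ) (y : κ → ℝ) (i : ι) :
    |x i - zs i| ≤ lyapunov N zs ls x y + A i i := by
  have h1 := two_mul_abs_le_of_inverse hN hNA (x - zs) i
  have h2 : 0 ≤ (y - ls) ⬝ᵥ (y - ls) := Finset.sum_nonneg fun i _ => mul_self_nonneg _
  have h3 : 0 ≤ A i i := by
    have := two_mul_abs_le_of_inverse hN hNA 0 i
    simpa using this
  rw [Pi.sub_apply] at h1
  unfold lyapunov
  linarith

theorem sq_sub_le_lyapunov_dual (hN : N.PosSemidef)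
    (zs : ι → ℝ) (ls : κ → ℝ) (x : ι → ℝ) (y : κ → ℝ) (k : κ) :
    (y k - ls k) ^ 2 ≤ 2 * lyapunov N zs ls x y := by
  have h1 := hN.dotProduct_mulVec_nonneg (x - zs)
  have h2 : (y - ls) k * (y - ls) k ≤ (y - ls) ⬝ᵥ (y - ls) :=
    Finset.single_le_sum (f := fun k => (y - ls) k * (y - ls) k)
      (fun i _ => mul_self_nonneg _) (Finset.mem_univ k)
  rw [star_trivial] at h1
  rw [Pi.sub_apply] at h2
  unfold lyapunov
  nlinarith

theorem continuous_dissipation (Q : Matrix ι ι ℝ) (B : Matrix κ ι ℝ) (c : κ → ℝ) (zs : ι → ℝ) :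
    Continuous fun p : (ι → ℝ) × (κ → ℝ) => dissipation Q B c zs p.1 p.2 := by
  unfold dissipation
  have h1 : Continuous fun p : (ι → ℝ) × (κ → ℝ) => p.1 - zs := by fun_prop
  exact (h1.dotProduct (continuous_const.matrix_mulVec h1)).sub
    (continuous_snd.dotProduct continuous_const)

theorem exists_compact [DecidableEq ι] (hf : IsPrimalDualFlow A Q B g c z l) (hN : N.PosSemidef)
    (hNA : N * A = 1) (hanti : AntitoneOn (fun t => lyapunov N zs ls (z t) (l t)) (Ici 0)) :
    ∃ K : Set ((ι → ℝ) × (κ → ℝ)), IsCompact K ∧ (∀ t, 0 ≤ t → (z t, l t) ∈ K) ∧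
      UniformContinuousOn (fun t => (z t, l t)) (Ici 0) := by
  set V0 := lyapunov N zs ls (z 0) (l 0) with hV0
  have hV0n : 0 ≤ V0 := lyapunov_nonneg hN _ _ _ _
  have hV : ∀ t, 0 ≤ t → lyapunov N zs ls (z t) (l t) ≤ V0 := fun t ht =>
    hanti (mem_Ici.2 le_rfl) (mem_Ici.2 ht) ht
  set K : Set ((ι → ℝ) × (κ → ℝ)) :=
    (Set.pi univ fun i => Metric.closedBall (zs i) (V0 + A i i)) ×ˢ
      (Set.pi univ fun k => Metric.closedBall (ls k) (2 * V0 + 1)) with hK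
  have hKc : IsCompact K :=
    (isCompact_univ_pi fun i => isCompact_closedBall _ _).prod
      (isCompact_univ_pi fun i => isCompact_closedBall _ _)
  have hmem : ∀ t, 0 ≤ t → (z t, l t) ∈ K := by
    intro t ht
    refine ⟨fun i _ => ?_, fun k _ => ?_⟩
    · rw [Metric.mem_closedBall, Real.dist_eq]
      linarith [abs_sub_le_lyapunov_primal hN hNA zs ls (z t) (l t) i, hV t ht]
    · rw [Metric.mem_closedBall, Real.dist_eq]
      have h1 := sq_sub_le_lyapunov_dual hN zs ls (z t) (l t) k
      exact abs_le_of_sq_le_sq (by nlinarith [hV t ht]) (by linarith)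
  refine ⟨K, hKc, hmem, ?_⟩
  have hF1 : Continuous fun p : (ι → ℝ) × (κ → ℝ) => -(A *ᵥ (Q *ᵥ p.1 + g + Bᵀ *ᵥ p.2)) := by
    fun_prop
  -- The dual velocity is discontinuous, but it is dominated by this continuous function, so both
  -- velocities are bounded on `K` and the trajectory is Lipschitz.
  have hF2 : Continuous fun p : (ι → ℝ) × (κ → ℝ) => c + B *ᵥ p.1 := by fun_prop
  obtain ⟨C1, hC1⟩ := hKc.exists_bound_of_continuousOn hF1.continuousOn
  obtain ⟨C2, hC2⟩ := hKc.exists_bound_of_continuousOn hF2.continuousOn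
  set C := max (max C1 C2) 0 with hC
  have hC0 : 0 ≤ C := le_max_right _ _
  have hz : ∀ i s t, 0 ≤ s → s ≤ t → |z t i - z s i| ≤ C * (t - s) := by
    intro i s t hs hst
    refine abs_sub_le_of_ae_hasDerivAt_bounded (φ := fun t => z t i)
      (φ' := fun t => (-(A *ᵥ (Q *ᵥ z t + g + Bᵀ *ᵥ l t))) i) (hf.ac_primal i) ?_ hs hst
    filter_upwards [hf.hasDerivAt] with t hd ht
    refine ⟨hasDerivAt_pi.1 (hd ht).1 i, ?_⟩
    exact ((norm_le_pi_norm _ i).trans (hC1 _ (hmem t ht))).trans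
      ((le_max_left _ _).trans (le_max_left _ _))
  have hl : ∀ k s t, 0 ≤ s → s ≤ t → |l t k - l s k| ≤ C * (t - s) := by
    intro k s t hs hst
    refine abs_sub_le_of_ae_hasDerivAt_bounded (φ := fun t => l t k)
      (φ' := fun t => DANA.posProj ((c + B *ᵥ z t) k) (l t k)) (hf.ac_dual k) ?_ hs hst
    filter_upwards [hf.hasDerivAt] with t hd ht
    refine ⟨hasDerivAt_pi.1 (hd ht).2 k, (DANA.abs_posProj_le _ _).trans ?_⟩
    exact ((norm_le_pi_norm _ k).trans (hC2 _ (hmem t ht))).trans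
      ((le_max_right _ _).trans (le_max_left _ _))
  have hlip : ∀ s t, 0 ≤ s → s ≤ t → dist (z t, l t) (z s, l s) ≤ C * (t - s) := by
    intro s t hs hst
    have h0 : 0 ≤ C * (t - s) := mul_nonneg hC0 (by linarith)
    exact max_le ((dist_pi_le_iff h0).2 fun i => hz i s t hs hst)
      ((dist_pi_le_iff h0).2 fun k => hl k s t hs hst)
  have : LipschitzOnWith C.toNNReal (fun t => (z t, l t)) (Ici 0) := by
    refine LipschitzOnWith.of_dist_le_mul fun s hs t ht => ?_
    rw [Real.coe_toNNReal _ hC0]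
    rcases le_total s t with h | h
    · rw [dist_comm, Real.dist_eq, abs_sub_comm, abs_of_nonneg (by linarith)]
      exact hlip s t hs h
    · rw [Real.dist_eq, abs_of_nonneg (by linarith)]
      exact hlip t s ht h
  exact this.uniformContinuousOn

theorem lyapunov_antitoneOn [DecidableEq ι] (hf : IsPrimalDualFlow A Q B g c z l) (hN : Nᵀ = N)
    (hNA : N * A = 1) (hk : IsKKT Q B g c zs ls)
    (hW : ∀ t, 0 ≤ t → 0 ≤ dissipation Q B c zs (z t) (l t)) :
    AntitoneOn (fun t => lyapunov N zs ls (z t) (l t)) (Ici 0) := by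
  obtain ⟨V', hV'⟩ := hf.lyapunov_deriv hN hNA hk
  refine antitoneOn_of_ae_hasDerivAt_nonpos (φ' := V') (hf.lyapunov_ac N zs ls) ?_
  filter_upwards [hV'] with t h ht
  exact ⟨(h ht).1, (h ht).2.trans (by linarith [hW t ht])⟩

/-- Convergence of the projected primal-dual dynamics of a quadratic program, when the quadratic
form is coercive along the differences `z t - zs`. -/
theorem tendsto_isKKT [DecidableEq ι] (hf : IsPrimalDualFlow A Q B g c z l) (hA : A.PosDef)
    (hl0 : ∀ k, 0 ≤ l 0 k) (hk : IsKKT Q B g c zs ls) {m : ℝ} (hm : 0 < m)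
    (hcoer : ∀ t, 0 ≤ t → m * ((z t - zs) ⬝ᵥ (z t - zs)) ≤ (z t - zs) ⬝ᵥ Q *ᵥ (z t - zs)) :
    Tendsto z atTop (𝓝 zs) ∧ ∃ ls', IsKKT Q B g c zs ls' ∧ Tendsto l atTop (𝓝 ls') := by
  obtain ⟨N, hN, hNA⟩ : ∃ N : Matrix ι ι ℝ, N.PosSemidef ∧ N * A = 1 :=
    ⟨A⁻¹, hA.inv.posSemidef, nonsing_inv_mul A ((isUnit_iff_isUnit_det A).1 hA.isUnit)⟩
  have hNt : Nᵀ = N := by simpa [Matrix.IsHermitian] using hN.1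
  have hsq : ∀ t, 0 ≤ (z t - zs) ⬝ᵥ (z t - zs) := fun t =>
    Finset.sum_nonneg fun i _ => mul_self_nonneg _
  have hslack : ∀ t, 0 ≤ t → ∀ k, l t k * (c + B *ᵥ zs) k ≤ 0 := fun t ht k =>
    mul_nonpos_of_nonneg_of_nonpos (hf.dual_nonneg hl0 ht k) (hk.feasible k)
  have hslack' : ∀ t, 0 ≤ t → l t ⬝ᵥ (c + B *ᵥ zs) ≤ 0 := fun t ht =>
    Finset.sum_nonpos fun k _ => hslack t ht k
  have hW1 : ∀ t, 0 ≤ t →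
      m * ((z t - zs) ⬝ᵥ (z t - zs)) - l t ⬝ᵥ (c + B *ᵥ zs) ≤
        dissipation Q B c zs (z t) (l t) := fun t ht => by
    unfold dissipation
    linarith [hcoer t ht]
  have hW : ∀ t, 0 ≤ t → 0 ≤ dissipation Q B c zs (z t) (l t) := fun t ht => by
    linarith [hW1 t ht, mul_nonneg hm.le (hsq t), hslack' t ht]
  have hanti := hf.lyapunov_antitoneOn hNt hNA hk hW
  obtain ⟨K, hK, hmem, huc⟩ := hf.exists_compact hN hNA hanti
  have hcomp : ∀ F : (ι → ℝ) × (κ → ℝ) → ℝ, Continuous F →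
      UniformContinuousOn (fun t => F (z t, l t)) (Ici 0) := fun F hF =>
    (hK.uniformContinuousOn_of_continuous hF.continuousOn).comp huc fun t ht => hmem t ht
  -- the dissipation tends to zero
  obtain ⟨V', hV'⟩ := hf.lyapunov_deriv hNt hNA hk
  obtain ⟨a, ha⟩ := tendsto_of_antitoneOn hanti fun t _ => lyapunov_nonneg hN _ _ _ _
  have hWlt : ∀ δ > 0, ∀ᶠ t in atTop, dissipation Q B c zs (z t) (l t) < δ := fun δ hδ =>
    eventually_lt_of_tendsto_of_ae_hasDerivAt_le (hf.lyapunov_ac N zs ls) hV'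
      (hcomp _ (continuous_dissipation Q B c zs)) ha hδ
  have hW0 : Tendsto (fun t => dissipation Q B c zs (z t) (l t)) atTop (𝓝 0) := by
    refine tendsto_order.2 ⟨fun δ hδ => ?_, hWlt⟩
    filter_upwards [eventually_ge_atTop 0] with t ht
    exact hδ.trans_le (hW t ht)
  have hz : Tendsto z atTop (𝓝 zs) := by
    rw [tendsto_pi_nhds]
    intro i
    have h1 : Tendsto (fun t => (z t i - zs i) ^ 2) atTop (𝓝 0) := by
      refine squeeze_zero' (.of_forall fun t => sq_nonneg _) ?_
        (by simpa using hW0.const_mul m⁻¹)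
      filter_upwards [eventually_ge_atTop 0] with t ht
      rw [← div_eq_inv_mul, le_div_iff₀ hm]
      have h2 : (z t - zs) i * (z t - zs) i ≤ (z t - zs) ⬝ᵥ (z t - zs) :=
        Finset.single_le_sum (f := fun k => (z t - zs) k * (z t - zs) k)
          (fun i _ => mul_self_nonneg _) (Finset.mem_univ i)
      rw [Pi.sub_apply] at h2
      nlinarith [hW1 t ht, hslack' t ht]
    have h2 : Tendsto (fun t => |z t i - zs i|) atTop (𝓝 0) := by
      have := h1.sqrt
      simpa [Real.sqrt_sq_eq_abs] using this
    have h3 := (tendsto_zero_iff_abs_tendsto_zero _).2 h2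
    simpa using h3.add_const (zs i)
  have hl1 : Tendsto (fun t => l t ⬝ᵥ (c + B *ᵥ zs)) atTop (𝓝 0) := by
    have : Tendsto (fun t => -(l t ⬝ᵥ (c + B *ᵥ zs))) atTop (𝓝 0) := by
      refine squeeze_zero' ?_ ?_ hW0
      · filter_upwards [eventually_ge_atTop 0] with t ht
        linarith [hslack' t ht]
      · filter_upwards [eventually_ge_atTop 0] with t ht
        linarith [hW1 t ht, mul_nonneg hm.le (hsq t)]
    simpa using this.neg
  -- the gradient tends to zero
  have hF : Continuous fun p : (ι → ℝ) × (κ → ℝ) => A *ᵥ (Q *ᵥ p.1 + g + Bᵀ *ᵥ p.2) := by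
    fun_prop
  have hAG : Tendsto (fun t => A *ᵥ (Q *ᵥ z t + g + Bᵀ *ᵥ l t)) atTop (𝓝 0) := by
    rw [tendsto_pi_nhds]
    intro i
    have hFi := (continuous_apply i).comp hF
    have hzi := (tendsto_pi_nhds.1 hz) i
    -- Barbalat again, now for the convergent coordinate itself, whose rate of decrease is exactly
    -- the weighted gradient; `hlo` applies it to the negated coordinate.
    have hup : ∀ δ > 0, ∀ᶠ t in atTop, (A *ᵥ (Q *ᵥ z t + g + Bᵀ *ᵥ l t)) i < δ := fun δ hδ =>
      eventually_lt_of_tendsto_of_ae_hasDerivAt_le (φ := fun t => z t i)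
        (φ' := fun t => (-(A *ᵥ (Q *ᵥ z t + g + Bᵀ *ᵥ l t))) i) (hf.ac_primal i)
        (by
          filter_upwards [hf.hasDerivAt] with t hd ht
          exact ⟨hasDerivAt_pi.1 (hd ht).1 i, le_rfl⟩) (hcomp _ hFi) hzi hδ
    have hlo : ∀ δ > 0, ∀ᶠ t in atTop, -(A *ᵥ (Q *ᵥ z t + g + Bᵀ *ᵥ l t)) i < δ := fun δ hδ =>
      eventually_lt_of_tendsto_of_ae_hasDerivAt_le (φ := fun t => -z t i)
        (φ' := fun t => -(-(A *ᵥ (Q *ᵥ z t + g + Bᵀ *ᵥ l t))) i)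
        (fun b hb => (hf.ac_primal i b hb).neg)
        (by
          filter_upwards [hf.hasDerivAt] with t hd ht
          exact ⟨(hasDerivAt_pi.1 (hd ht).1 i).neg, by simp⟩) (hcomp _ hFi.neg) hzi.neg hδ
    refine tendsto_order.2 ⟨fun δ hδ => ?_, hup⟩
    filter_upwards [hlo (-δ) (neg_pos.2 hδ)] with t ht
    simpa using ht
  have hG : Tendsto (fun t => Q *ᵥ z t + g + Bᵀ *ᵥ l t) atTop (𝓝 0) := by
    have hc : Continuous fun v : ι → ℝ => N *ᵥ v := by fun_prop
    have := (hc.tendsto 0).comp hAG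
    simpa [Function.comp_def, mulVec_mulVec, ← Matrix.mul_assoc, hNA] using this
  -- a limit point of the dual trajectory is a multiplier
  obtain ⟨⟨z', ls'⟩, -, ψ, hψ, hlim⟩ := hK.tendsto_subseq (x := fun n : ℕ => (z n, l n))
    fun n => hmem n n.cast_nonneg
  have hψt : Tendsto (fun n => ((ψ n : ℕ) : ℝ)) atTop atTop :=
    tendsto_natCast_atTop_atTop.comp hψ.tendsto_atTop
  have hlψ : Tendsto (fun n => l (ψ n)) atTop (𝓝 ls') :=
    (continuous_snd.tendsto _).comp hlim
  have hk' : IsKKT Q B g c zs ls' := by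
    refine ⟨?_, hk.feasible, fun k => ?_, ?_⟩
    · have h1 : Continuous fun p : (ι → ℝ) × (κ → ℝ) => Q *ᵥ p.1 + g + Bᵀ *ᵥ p.2 := by fun_prop
      have h2 := (h1.tendsto (zs, ls')).comp ((hz.comp hψt).prodMk_nhds hlψ)
      exact tendsto_nhds_unique h2 (hG.comp hψt)
    · exact ge_of_tendsto' ((tendsto_pi_nhds.1 hlψ) k) fun n =>
        hf.dual_nonneg hl0 (Nat.cast_nonneg _) k
    · have h1 : Continuous fun y : κ → ℝ => y ⬝ᵥ (c + B *ᵥ zs) :=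
        continuous_id.dotProduct continuous_const
      exact tendsto_nhds_unique ((h1.tendsto ls').comp hlψ) (hl1.comp hψt)
  refine ⟨hz, ls', hk', ?_⟩
  -- The dissipation does not involve the multiplier, so its sign `hW` serves unchanged for the
  -- Lyapunov function recentred at `ls'`.
  have hanti' := hf.lyapunov_antitoneOn hNt hNA hk' hW
  obtain ⟨b, hb⟩ := tendsto_of_antitoneOn hanti' fun t _ => lyapunov_nonneg hN _ _ _ _
  have hb0 : b = 0 := by
    have h1 : Continuous fun p : (ι → ℝ) × (κ → ℝ) => lyapunov N zs ls' p.1 p.2 := by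
      unfold lyapunov
      have h1 : Continuous fun p : (ι → ℝ) × (κ → ℝ) => p.1 - zs := by fun_prop
      have h2 : Continuous fun p : (ι → ℝ) × (κ → ℝ) => p.2 - ls' := by fun_prop
      exact ((h1.dotProduct (continuous_const.matrix_mulVec h1)).const_mul _).add
        ((h2.dotProduct h2).const_mul _)
    have h2 := (h1.tendsto (zs, ls')).comp ((hz.comp hψt).prodMk_nhds hlψ)
    have h3 := tendsto_nhds_unique (hb.comp hψt) h2
    simpa [lyapunov] using h3
  rw [hb0] at hb
  rw [tendsto_pi_nhds]
  intro k
  have h1 : Tendsto (fun t => (l t k - ls' k) ^ 2) atTop (𝓝 0) :=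
    squeeze_zero (fun t => sq_nonneg _)
      (fun t => sq_sub_le_lyapunov_dual hN zs ls' (z t) (l t) k) (by simpa using hb.const_mul 2)
  have h2 : Tendsto (fun t => |l t k - ls' k|) atTop (𝓝 0) := by
    have := h1.sqrt
    simpa [Real.sqrt_sq_eq_abs] using this
  have h3 := (tendsto_zero_iff_abs_tendsto_zero _).2 h2
  simpa using h3.add_const (ls' k)

end IsPrimalDualFlow

/-! ### Convex quadratic programs: multipliers and existence of optima. -/

section QuadraticProgram

variable {ι κ : Type*} [Fintype ι] [Fintype κ]

/-- The quadratic cost `z ⬝ᵥ Q *ᵥ z / 2 + g ⬝ᵥ z`. -/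
def quadCost (Q : Matrix ι ι ℝ) (g z : ι → ℝ) : ℝ := 1 / 2 * (z ⬝ᵥ Q *ᵥ z) + g ⬝ᵥ z

variable {Q : Matrix ι ι ℝ} {B : Matrix κ ι ℝ} {g : ι → ℝ} {c : κ → ℝ}

theorem dotProduct_mulVec_comm_of_isSymm (hQ : Qᵀ = Q) (x y : ι → ℝ) :
    x ⬝ᵥ Q *ᵥ y = y ⬝ᵥ Q *ᵥ x := by
  rw [dotProduct_mulVec, ← mulVec_transpose, hQ, dotProduct_comm]

theorem quadCost_add (hQ : Qᵀ = Q) (z h : ι → ℝ) :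
    quadCost Q g (z + h) = quadCost Q g z + (Q *ᵥ z + g) ⬝ᵥ h + 1 / 2 * (h ⬝ᵥ Q *ᵥ h) := by
  have h1 := dotProduct_mulVec_comm_of_isSymm hQ z h
  have h2 : (Q *ᵥ z) ⬝ᵥ h = h ⬝ᵥ Q *ᵥ z := dotProduct_comm _ _
  simp only [quadCost, mulVec_add, dotProduct_add, add_dotProduct, h1, h2]
  ring

theorem quadCost_combo_le (hQ : Q.PosSemidef) (x y : ι → ℝ) {a b : ℝ} (ha : 0 ≤ a) (hb : 0 ≤ b)
    (hab : a + b = 1) :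
    quadCost Q g (a • x + b • y) ≤ a * quadCost Q g x + b * quadCost Q g y := by
  have hQt : Qᵀ = Q := by simpa [Matrix.IsHermitian] using hQ.1
  have h1 := hQ.dotProduct_mulVec_nonneg (x - y)
  have h2 := dotProduct_mulVec_comm_of_isSymm hQt x y
  have h3 : 0 ≤ a * b := mul_nonneg ha hb
  obtain rfl : b = 1 - a := by linarith
  simp only [star_trivial, quadCost, mulVec_add, mulVec_sub, mulVec_smul, dotProduct_add,
    dotProduct_sub, sub_dotProduct, add_dotProduct, dotProduct_smul, smul_dotProduct, smul_eq_mul,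
    h2] at h1 ⊢
  nlinarith [mul_nonneg h3 h1]

theorem continuous_quadCost (Q : Matrix ι ι ℝ) (g : ι → ℝ) : Continuous (quadCost Q g) := by
  unfold quadCost
  exact ((continuous_id.dotProduct (continuous_const.matrix_mulVec continuous_id)).const_mul _).add
    (continuous_const.dotProduct continuous_id)

/-- Lagrange multipliers of a convex program that satisfies Slater's condition. -/
theorem exists_multiplier (hQ : Q.PosSemidef) {p : ℝ}
    (hmin : ∀ z, (∀ k, (c + B *ᵥ z) k ≤ 0) → p ≤ quadCost Q g z) {y : ι → ℝ}
    (hy : ∀ k, (c + B *ᵥ y) k < 0) :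
    ∃ μ : κ → ℝ, (∀ k, 0 ≤ μ k) ∧ ∀ z, p ≤ quadCost Q g z + μ ⬝ᵥ (c + B *ᵥ z) := by
  classical
  -- Pairs of a cost level and constraint levels that some point strictly beats. Strictness makes
  -- the set open, so that Hahn-Banach separates it from `(p, 0)`.
  set S : Set (ℝ × (κ → ℝ)) :=
    ⋃ z : ι → ℝ, Ioi (quadCost Q g z) ×ˢ Set.pi univ fun k => Ioi ((c + B *ᵥ z) k) with hS
  have hmem : ∀ r u, (r, u) ∈ S ↔ ∃ z, quadCost Q g z < r ∧ ∀ k, (c + B *ᵥ z) k < u k := by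
    intro r u
    simp [hS]
  have hopen : IsOpen S := isOpen_iUnion fun z =>
    isOpen_Ioi.prod (isOpen_set_pi finite_univ fun k _ => isOpen_Ioi)
  have hconv : Convex ℝ S := by
    rw [convex_iff_forall_pos]
    rintro ⟨r, u⟩ h1 ⟨r', u'⟩ h2 a b ha hb hab
    obtain ⟨x, hx, hxu⟩ := (hmem _ _).1 h1
    obtain ⟨x', hx', hxu'⟩ := (hmem _ _).1 h2
    refine (hmem _ _).2 ⟨a • x + b • x', ?_, fun k => ?_⟩
    · refine (quadCost_combo_le hQ x x' ha.le hb.le hab).trans_lt ?_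
      exact add_lt_add (mul_lt_mul_of_pos_left hx ha) (mul_lt_mul_of_pos_left hx' hb)
    · have e : (c + B *ᵥ (a • x + b • x')) k = a * (c + B *ᵥ x) k + b * (c + B *ᵥ x') k := by
        simp only [mulVec_add, mulVec_smul, Pi.add_apply, Pi.smul_apply, smul_eq_mul]
        linear_combination -c k * hab
      rw [e]
      exact add_lt_add (mul_lt_mul_of_pos_left (hxu k) ha) (mul_lt_mul_of_pos_left (hxu' k) hb)
  have hnot : (p, (0 : κ → ℝ)) ∉ S := by
    intro h
    obtain ⟨z, hz, hzu⟩ := (hmem _ _).1 h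
    exact absurd (hmin z fun k => (hzu k).le) (not_le.2 hz)
  obtain ⟨F, hF⟩ := geometric_hahn_banach_open_point hconv hopen hnot
  set α := F (1, 0) with hα
  set β : κ → ℝ := fun k => F (0, Pi.single k 1) with hβ
  have hFeq : ∀ r u, F (r, u) = α * r + β ⬝ᵥ u := by
    intro r u
    have e : ((r, u) : ℝ × (κ → ℝ)) = r • (1, 0) + ∑ k, u k • (0, Pi.single k 1) := by
      ext j
      · simp [Prod.fst_sum]
      · simp [Prod.snd_sum, Finset.sum_apply, Pi.single_apply]
    rw [e, map_add, map_smul, map_sum]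
    simp only [map_smul, smul_eq_mul, dotProduct]
    rw [mul_comm]
    simp [hα, hβ, mul_comm]
  simp only [Prod.forall, hFeq, dotProduct_zero, add_zero] at hF
  -- The Slater point puts `(r, 0)` in `S` for large `r`, which excludes a vertical separating
  -- hyperplane.
  have hαneg : α < 0 := by
    have := hF (max (quadCost Q g y) p + 1) 0
      ((hmem _ _).2 ⟨y, by linarith [le_max_left (quadCost Q g y) p], hy⟩)
    rw [dotProduct_zero, add_zero] at this
    by_contra! hα0
    nlinarith [le_max_right (quadCost Q g y) p]
  have hβnonpos : ∀ k, β k ≤ 0 := by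
    intro k
    by_contra! hk
    set r := quadCost Q g y + 1
    -- Raising a constraint level stays in `S`; this height would violate the separation if `β k`
    -- were positive.
    set M := max ((α * p - α * r) / β k) 0
    have := hF r (Pi.single k M) ((hmem _ _).2 ⟨y, by simp [r], fun j => (hy j).trans_le (by
      rw [Pi.single_apply]; split_ifs
      · exact le_max_right _ _
      · exact le_rfl)⟩)
    rw [dotProduct_single] at this
    have h1 : (α * p - α * r) / β k ≤ M := le_max_left _ _
    rw [div_le_iff₀ hk] at h1
    linarith
  refine ⟨fun k => β k / α, fun k => div_nonneg_of_nonpos (hβnonpos k) hαneg.le, fun z => ?_⟩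
  have hlim : α * quadCost Q g z + β ⬝ᵥ (c + B *ᵥ z) ≤ α * p := by
    have hc : Tendsto (fun η : ℝ => α * (quadCost Q g z + η) +
        β ⬝ᵥ (c + B *ᵥ z + fun _ => η)) (𝓝[>] 0)
        (𝓝 (α * (quadCost Q g z + 0) + β ⬝ᵥ (c + B *ᵥ z + fun _ => 0))) := by
      have h1 : Continuous fun η : ℝ => (c + B *ᵥ z + fun _ => η : κ → ℝ) := by fun_prop
      have h2 : Continuous fun η : ℝ => α * (quadCost Q g z + η) +
          β ⬝ᵥ (c + B *ᵥ z + fun _ => η) :=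
        (by fun_prop : Continuous fun η : ℝ => α * (quadCost Q g z + η)).add
          (continuous_const.dotProduct h1)
      exact (h2.tendsto 0).mono_left nhdsWithin_le_nhds
    have h3 := le_of_tendsto hc (b := α * p) (by
      filter_upwards [self_mem_nhdsWithin] with η hη
      have hη' : 0 < η := hη
      exact (hF _ _ ((hmem _ _).2 ⟨z, by linarith, fun k => by
        simpa using hη'⟩)).le)
    have h4 : (fun _ => 0 : κ → ℝ) = 0 := rfl
    simpa [h4] using h3
  have h5 : (fun k => β k / α) ⬝ᵥ (c + B *ᵥ z) = (β ⬝ᵥ (c + B *ᵥ z)) / α := by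
    simp only [dotProduct, Finset.sum_div]
    exact Finset.sum_congr rfl fun k _ => by ring
  rw [h5]
  have h6 : α * (quadCost Q g z + β ⬝ᵥ (c + B *ᵥ z) / α) ≤ α * p := by
    rw [mul_add, mul_div_cancel₀ _ hαneg.ne]
    exact hlim
  exact (mul_le_mul_left_of_neg hαneg).1 h6

/-- Along `-s • v` the linear term wins for small `s`; the choice of `s` below keeps the quadratic
term at most half of it. -/
theorem eq_zero_of_forall_linear_add_quad_nonneg {v : ι → ℝ}
    (h : ∀ x, 0 ≤ v ⬝ᵥ x + 1 / 2 * (x ⬝ᵥ Q *ᵥ x)) : v = 0 := by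
  by_contra hv
  have hpos : 0 < v ⬝ᵥ v :=
    lt_of_le_of_ne (Finset.sum_nonneg fun i _ => mul_self_nonneg _)
      fun h0 => hv (dotProduct_self_eq_zero.1 h0.symm)
  set A := v ⬝ᵥ v
  set D := v ⬝ᵥ Q *ᵥ v
  set s := A / (|D| + 1)
  have hs : 0 < s := by positivity
  have h1 := h (-s • v)
  simp only [dotProduct_smul, smul_dotProduct, mulVec_smul, smul_eq_mul] at h1
  change 0 ≤ -s * A + 1 / 2 * (-s * (-s * D)) at h1
  have h2 : s * (|D| + 1) = A := div_mul_cancel₀ _ (by positivity)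
  have h3 := le_abs_self D
  have h4 : 0 ≤ s * (1 / 2 * s * D - A) := by linarith
  have h5 : 0 ≤ 1 / 2 * s * D - A := nonneg_of_mul_nonneg_right h4 hs
  nlinarith [mul_le_mul_of_nonneg_left h3 hs.le]

/-- The multiplier inequality at `zs` itself forces slackness; then `zs` minimizes the Lagrangian,
which gives stationarity. -/
theorem exists_isKKT (hQ : Q.PosSemidef) {zs : ι → ℝ} (hfeas : ∀ k, (c + B *ᵥ zs) k ≤ 0)
    (hmin : ∀ z, (∀ k, (c + B *ᵥ z) k ≤ 0) → quadCost Q g zs ≤ quadCost Q g z) {y : ι → ℝ}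
    (hy : ∀ k, (c + B *ᵥ y) k < 0) : ∃ ls, IsKKT Q B g c zs ls := by
  have hQt : Qᵀ = Q := by simpa [Matrix.IsHermitian] using hQ.1
  obtain ⟨μ, hμ, hlag⟩ := exists_multiplier hQ hmin hy
  have hslack : μ ⬝ᵥ (c + B *ᵥ zs) = 0 := by
    refine le_antisymm (Finset.sum_nonpos fun k _ =>
      mul_nonpos_of_nonneg_of_nonpos (hμ k) (hfeas k)) ?_
    linarith [hlag zs]
  refine ⟨μ, ?_, hfeas, hμ, hslack⟩
  refine eq_zero_of_forall_linear_add_quad_nonneg (Q := Q) fun h => ?_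
  have h1 := hlag (zs + h)
  have h2 : μ ⬝ᵥ B *ᵥ h = (Bᵀ *ᵥ μ) ⬝ᵥ h := by
    rw [dotProduct_mulVec, mulVec_transpose]
  rw [quadCost_add hQt, mulVec_add, ← add_assoc, dotProduct_add, hslack, h2] at h1
  rw [add_dotProduct]
  linarith

/-- The Lagrangian at a multiplier of a KKT pair is an exact quadratic around the primal point. -/
theorem IsKKT.lagrangian_eq (hQ : Qᵀ = Q) {zs : ι → ℝ} {ls : κ → ℝ}
    (hk : IsKKT Q B g c zs ls) (z : ι → ℝ) :
    quadCost Q g z + ls ⬝ᵥ (c + B *ᵥ z) =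
      quadCost Q g zs + 1 / 2 * ((z - zs) ⬝ᵥ Q *ᵥ (z - zs)) := by
  obtain ⟨h, rfl⟩ : ∃ h, z = zs + h := ⟨z - zs, by abel⟩
  have h2 : ls ⬝ᵥ B *ᵥ h = (Bᵀ *ᵥ ls) ⬝ᵥ h := by
    rw [dotProduct_mulVec, mulVec_transpose]
  have h3 : (Q *ᵥ zs + g) ⬝ᵥ h + (Bᵀ *ᵥ ls) ⬝ᵥ h = 0 := by
    rw [← add_dotProduct, hk.stationary, zero_dotProduct]
  rw [quadCost_add hQ, mulVec_add, ← add_assoc c, dotProduct_add, h2, hk.slack,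
    add_sub_cancel_left]
  linarith

omit [Fintype κ] in
/-- Shifts along a direction in the kernel of the data change neither cost nor constraints, so
that the optimum is attained on every slice transversal to that direction. -/
theorem exists_optimum_on_slice {e : ι → ℝ} (he : 0 < e ⬝ᵥ e) (hQ : Qᵀ = Q) (hQe : Q *ᵥ e = 0)
    (hBe : B *ᵥ e = 0) (hge : g ⬝ᵥ e = 0) {m R : ℝ} (hm : 0 < m)
    (hcoer : ∀ v, e ⬝ᵥ v = 0 → m * (v ⬝ᵥ v) ≤ v ⬝ᵥ Q *ᵥ v)
    (hR : ∀ x y, (∀ k, (c + B *ᵥ x) k ≤ 0) → (∀ k, (c + B *ᵥ y) k ≤ 0) →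
      (x - y) ⬝ᵥ Q *ᵥ (x - y) ≤ R)
    {y : ι → ℝ} (hy : ∀ k, (c + B *ᵥ y) k ≤ 0) (s : ℝ) :
    ∃ zs, e ⬝ᵥ zs = s ∧ (∀ k, (c + B *ᵥ zs) k ≤ 0) ∧
      ∀ z, (∀ k, (c + B *ᵥ z) k ≤ 0) → quadCost Q g zs ≤ quadCost Q g z := by
  have hBsh : ∀ z (α : ℝ), B *ᵥ (z + α • e) = B *ᵥ z := fun z α => by
    rw [mulVec_add, mulVec_smul, hBe, smul_zero, add_zero]
  have hcost : ∀ z (α : ℝ), quadCost Q g (z + α • e) = quadCost Q g z := fun z α => by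
    have h1 : (Q *ᵥ z) ⬝ᵥ e = 0 := by
      rw [dotProduct_comm, dotProduct_mulVec_comm_of_isSymm hQ, hQe, dotProduct_zero]
    rw [quadCost_add hQ, mulVec_smul, hQe, add_dotProduct, dotProduct_smul, dotProduct_smul, h1,
      hge]
    simp
  have hshift : ∀ z, ∃ α : ℝ, e ⬝ᵥ (z + α • e) = s := fun z =>
    ⟨(s - e ⬝ᵥ z) / (e ⬝ᵥ e), by
      rw [dotProduct_add, dotProduct_smul, smul_eq_mul, div_mul_cancel₀ _ he.ne']; ring⟩
  set S : Set (ι → ℝ) := {z | e ⬝ᵥ z = s ∧ ∀ k, (c + B *ᵥ z) k ≤ 0} with hS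
  obtain ⟨α, hα⟩ := hshift y
  set y' := y + α • e with hy'
  have hyS : y' ∈ S := ⟨hα, by rw [hy', hBsh]; exact hy⟩
  have hclosed : IsClosed S := by
    have h1 : Continuous fun z : ι → ℝ => e ⬝ᵥ z := continuous_const.dotProduct continuous_id
    have h2 : Continuous fun z : ι → ℝ => c + B *ᵥ z := by fun_prop
    refine (isClosed_eq h1 continuous_const).inter ?_
    exact (isClosed_Iic (a := (0 : κ → ℝ))).preimage h2
  -- Differences within the slice are orthogonal to `e`, so coercivity turns the bound `R` on the
  -- form into a bound on their length.
  have hcompact : IsCompact S := by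
    refine (isCompact_univ_pi fun i => isCompact_closedBall (y' i) (R / m + 1)).of_isClosed_subset
      hclosed fun z hz i _ => ?_
    have h1 : e ⬝ᵥ (z - y') = 0 := by rw [dotProduct_sub, hz.1, hα, sub_self]
    have h2 := (hcoer _ h1).trans (hR z y' hz.2 hyS.2)
    have h3 : (z - y') i * (z - y') i ≤ (z - y') ⬝ᵥ (z - y') :=
      Finset.single_le_sum (f := fun k => (z - y') k * (z - y') k)
        (fun i _ => mul_self_nonneg _) (Finset.mem_univ i)
    have h4 : (z - y') ⬝ᵥ (z - y') ≤ R / m := by rw [le_div_iff₀ hm]; linarith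
    rw [Metric.mem_closedBall, Real.dist_eq]
    rw [Pi.sub_apply] at h3
    have h5 : 0 ≤ R / m := by nlinarith [mul_self_nonneg (z i - y' i)]
    exact abs_le_of_sq_le_sq (by nlinarith) (by linarith)
  obtain ⟨zs, hzs, hmin⟩ := hcompact.exists_isMinOn ⟨y', hyS⟩ (continuous_quadCost Q g).continuousOn
  refine ⟨zs, hzs.1, hzs.2, fun z hz => ?_⟩
  obtain ⟨β, hβ⟩ := hshift z
  rw [← hcost z β]
  exact hmin ⟨hβ, by rw [hBsh]; exact hz⟩

end QuadraticProgram

/-! ### The Laplacian and the orthogonal change of coordinates. -/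

namespace DANA

theorem weightedLaplacian_transpose {n : ℕ} (G : SimpleGraph (Fin n)) [DecidableRel G.Adj]
    (w : Fin n → Fin n → ℝ) (hw : ∀ i j, w i j = w j i) :
    (weightedLaplacian G w)ᵀ = weightedLaplacian G w := by
  ext i j
  simp only [transpose_apply, weightedLaplacian, of_apply]
  rcases eq_or_ne i j with rfl | h
  · simp
  · simp [h, h.symm, G.adj_comm j i, hw j i]

theorem weightedLaplacian_mulVec_one {n : ℕ} (G : SimpleGraph (Fin n)) [DecidableRel G.Adj]
    (w : Fin n → Fin n → ℝ) : weightedLaplacian G w *ᵥ 1 = 0 := by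
  ext i
  have h : ∀ j, weightedLaplacian G w i j =
      (if i = j then ∑ k ∈ G.neighborFinset i, w i k else 0) - if G.Adj i j then w i j else 0 := by
    intro j
    rcases eq_or_ne i j with rfl | h
    · simp [weightedLaplacian]
    · by_cases h' : G.Adj i j <;> simp [weightedLaplacian, h, h']
  simp only [mulVec, dotProduct, Pi.one_apply, mul_one, Pi.zero_apply, h, Finset.sum_sub_distrib]
  simp [SimpleGraph.neighborFinset_eq_filter, Finset.sum_filter]

theorem coordT_transpose_mul_self {n : ℕ} : (coordT n)ᵀ * coordT n = 1 := by
  rcases n with _ | m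
  · ext i; exact i.elim0
  set s := √((m + 1 : ℕ) : ℝ) with hs
  have hs2 : s ^ 2 = m + 1 := by rw [hs, Real.sq_sqrt (by positivity)]; push_cast; ring
  have hs0 : 0 < s := by rw [hs]; positivity
  set C := (√(((m + 1 : ℕ) : ℝ) * ((m + 1 : ℕ) + 1 + 2 * s)))⁻¹ with hC
  have hC2 : C ^ 2 * ((m + 1) * (m + 2 + 2 * s)) = 1 := by
    rw [hC, inv_pow, Real.sq_sqrt (by positivity)]
    push_cast
    have : ((m : ℝ) + 1) * (m + 1 + 1 + 2 * s) ≠ 0 := by positivity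
    field_simp
    ring
  -- Unnormalized columns, written as a combination of the all-ones vector and two basis vectors. As
  -- the entries of each sum to zero, an inner product of two columns only needs two entries.
  set u : Fin (m + 1) → Fin (m + 1) → ℝ := fun j i =>
    -1 + (m + 1 + s) * (if i = j then 1 else 0) - s * (if i = Fin.last m then 1 else 0) with hu
  have hlast : ∀ i, coordT (m + 1) i (Fin.last m) = 1 / s := by
    intro i; simp [coordT, hs]
  have hother : ∀ i j, j ≠ Fin.last m → coordT (m + 1) i j = C * u j i := by
    intro i j hj
    have hj' : ¬ ((j : ℕ) = m) := fun h => hj (Fin.ext h)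
    rcases eq_or_ne i (Fin.last m) with rfl | hi
    · simp [coordT, hj', hC, hu, hs, hj.symm]
    · have hi' : ¬ ((i : ℕ) = m) := fun h => hi (Fin.ext h)
      rcases eq_or_ne i j with rfl | hij
      · simp [coordT, hi', hC, hu, hs, hi]
        left; ring
      · simp [coordT, hj', hi', hC, hu, hs, hi, hij]
  have husum : ∀ j, ∑ i, u j i = 0 := by
    intro j
    simp [hu, Finset.sum_add_distrib, Finset.sum_sub_distrib]
    ring
  have hudot : ∀ j k, j ≠ Fin.last m → k ≠ Fin.last m →
      ∑ i, u j i * u k i = if j = k then (m + 1) * (m + 2 + 2 * s) else 0 := by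
    intro j k hj hk
    have e : ∀ i, u j i * u k i = -u k i + (m + 1 + s) * (if i = j then u k i else 0) -
        s * (if i = Fin.last m then u k i else 0) := by
      intro i
      simp only [hu]
      split_ifs <;> ring
    simp only [e, Finset.sum_add_distrib, Finset.sum_sub_distrib, ← Finset.mul_sum,
      Finset.sum_neg_distrib, husum, Finset.sum_ite_eq', Finset.mem_univ, if_true]
    rcases eq_or_ne j k with rfl | hjk
    · simp only [hu, hj, hj.symm, if_true, if_false]
      nlinarith
    · simp only [hu, hj, hk.symm, hjk, if_true, if_false]
      nlinarith
  ext j k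
  rw [mul_apply, one_apply]
  simp only [transpose_apply]
  by_cases hj : j = Fin.last m <;> by_cases hk : k = Fin.last m
  · subst hj; subst hk
    simp only [hlast, Finset.sum_const, Finset.card_univ, Fintype.card_fin, if_true]
    rw [nsmul_eq_mul]
    push_cast
    rw [← hs2]
    field_simp
  · subst hj
    simp only [hlast, hother _ _ hk, if_neg (Ne.symm hk)]
    rw [← Finset.mul_sum, ← Finset.mul_sum, husum]
    simp
  · subst hk
    simp only [hlast, hother _ _ hj, if_neg hj]
    rw [← Finset.sum_mul, ← Finset.mul_sum, husum]
    simp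
  · simp only [hother _ _ hj, hother _ _ hk]
    have e : ∀ i, C * u j i * (C * u k i) = C ^ 2 * (u j i * u k i) := fun i => by ring
    simp only [e, ← Finset.mul_sum, hudot j k hj hk]
    split_ifs
    · exact hC2
    · simp

/-- Vectors orthogonal to the all-ones vector are isometric images of `T Jᵀ`. -/
theorem exists_coordT_projJ_mulVec {n : ℕ} {v : Fin n → ℝ} (hv : 1 ⬝ᵥ v = 0) :
    ∃ x : Fin (n - 1) → ℝ, (coordT n * (projJ n)ᵀ) *ᵥ x = v ∧ x ⬝ᵥ x = v ⬝ᵥ v := by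
  rcases n with _ | m
  · exact ⟨0, by ext i; exact i.elim0, by simp [dotProduct]⟩
  have hT := coordT_transpose_mul_self (n := m + 1)
  have hT' : coordT (m + 1) * (coordT (m + 1))ᵀ = 1 := mul_eq_one_comm.1 hT
  set y := (coordT (m + 1))ᵀ *ᵥ v with hy
  -- The coordinate deleted by `projJ` is a multiple of `1 ⬝ᵥ v`, so nothing is lost.
  have hylast : y (Fin.last m) = 0 := by
    have : y (Fin.last m) = 1 / √((m + 1 : ℕ) : ℝ) * (1 ⬝ᵥ v) := by
      simp [hy, mulVec, dotProduct, coordT, Finset.mul_sum]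
    rw [this, hv, mul_zero]
  set x : Fin (m + 1 - 1) → ℝ := fun i => y (Fin.castSucc i) with hx
  have hJx : (projJ (m + 1))ᵀ *ᵥ x = y := by
    ext i
    refine Fin.lastCases ?_ (fun i => ?_) i
    · rw [hylast]
      simp only [mulVec, dotProduct, transpose_apply, projJ, of_apply, Fin.val_last]
      change ∑ k : Fin m, (if (k : ℕ) = m then (1 : ℝ) else 0) * x k = 0
      refine Finset.sum_eq_zero fun k _ => ?_
      rw [if_neg (ne_of_lt k.2), zero_mul]
    · simp only [mulVec, dotProduct, transpose_apply, projJ, of_apply, Fin.val_castSucc]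
      change ∑ k : Fin m, (if (k : ℕ) = i then (1 : ℝ) else 0) * x k = y i.castSucc
      rw [Finset.sum_eq_single i]
      · simp [hx]
      · intro k _ hk
        rw [if_neg (fun h => hk (Fin.ext h)), zero_mul]
      · simp
  refine ⟨x, ?_, ?_⟩
  · rw [← mulVec_mulVec, hJx, hy, mulVec_mulVec, hT', one_mulVec]
  · have h1 : y ⬝ᵥ y = v ⬝ᵥ v := by
      rw [hy, dotProduct_mulVec, vecMul_transpose, mulVec_mulVec, hT', one_mulVec]
    rw [← h1]
    simp only [dotProduct]
    rw [Fin.sum_univ_castSucc, hylast]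
    simp [hx]

end DANA

/-! ### Positivity of the truncated Neumann weighting. -/

section

variable {n : ℕ}

/-- Truncated Neumann sums `∑_{p ≤ q} R ^ p` of a symmetric matrix are positive definite as soon
as `1 + R` is. -/
theorem posDef_sum_range_pow {ι : Type*} [Fintype ι] [DecidableEq ι] {R : Matrix ι ι ℝ}
    (hR : Rᵀ = R) (h : (1 + R).PosDef) (q : ℕ) : (∑ p ∈ Finset.range (q + 1), R ^ p).PosDef := by
  -- Steps of length two, via S_{q+2} = (1 + R) + R S_q R, treat even and odd `q` alike.
  induction q using Nat.strong_induction_on with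
  | _ q ih =>
    match q, ih with
    | 0, _ => simpa using PosDef.one
    | 1, _ => simpa [Finset.sum_range_succ] using h
    | q + 2, ih =>
      have h1 := (ih q (by omega)).posSemidef.conjTranspose_mul_mul_same R
      rw [conjTranspose_eq_transpose_of_trivial, hR] at h1
      have h2 : ∑ p ∈ Finset.range (q + 2 + 1), R ^ p =
          (1 + R) + R * (∑ p ∈ Finset.range (q + 1), R ^ p) * R := by
        rw [Finset.sum_range_succ', Finset.sum_range_succ', Finset.mul_sum, Finset.sum_mul]
        have : ∀ p, R ^ (p + 1 + 1) = R * R ^ p * R := fun p => by rw [pow_succ, pow_succ']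
        simp only [this]
        simp only [zero_add, pow_one, pow_zero]
        abel
      rw [h2]
      exact h.add_posSemidef h1

theorem vecMul_sum_range_pow {ι : Type*} [Fintype ι] [DecidableEq ι] {R : Matrix ι ι ℝ}
    {e : ι → ℝ} (h : e ᵥ* R = e) (q : ℕ) :
    e ᵥ* (∑ p ∈ Finset.range (q + 1), R ^ p) = ((q : ℝ) + 1) • e := by
  have hp : ∀ p : ℕ, e ᵥ* R ^ p = e := by
    intro p
    induction p with
    | zero => simp
    | succ p ih => rw [pow_succ, ← vecMul_vecMul, ih, h]
  induction q with
  | zero => simp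
  | succ q ih =>
    rw [Finset.sum_range_succ, vecMul_add, ih, hp]
    push_cast
    module

/-- Split off the all-ones component: `Q` vanishes on it, leaving twice its squared norm, while on
the complement at least `1 - ε` of the squared norm survives. -/
theorem posDef_two_sub {Q : Matrix (Fin n) (Fin n) ℝ} (hQ : Qᵀ = Q) (hQ1 : Q *ᵥ 1 = 0) {ε : ℝ}
    (hε : ε < 1) (hup : ∀ v, 1 ⬝ᵥ v = 0 → v ⬝ᵥ Q *ᵥ v ≤ (1 + ε) * (v ⬝ᵥ v)) :
    (1 + (1 - Q)).PosDef := by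
  refine .of_dotProduct_mulVec_pos ?_ fun v hv => ?_
  · rw [IsHermitian, conjTranspose_eq_transpose_of_trivial]
    simp [hQ]
  rcases n with _ | m
  · exact absurd (Subsingleton.elim _ _) hv
  have hone : (1 : Fin (m + 1) → ℝ) ⬝ᵥ 1 = m + 1 := by simp [dotProduct]
  set α : ℝ := (1 ⬝ᵥ v) / (m + 1) with hα
  set u := v - α • (1 : Fin (m + 1) → ℝ) with hu
  have hv' : v = u + α • (1 : Fin (m + 1) → ℝ) := by rw [hu]; abel
  have h1u : 1 ⬝ᵥ u = 0 := by
    rw [hu, dotProduct_sub, dotProduct_smul, hone, smul_eq_mul, hα,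
      div_mul_cancel₀ _ (by positivity), sub_self]
  have hu1 : u ⬝ᵥ 1 = 0 := by rw [dotProduct_comm, h1u]
  have hvv : v ⬝ᵥ v = u ⬝ᵥ u + α ^ 2 * (m + 1) := by
    rw [hv']
    simp only [dotProduct_add, add_dotProduct, dotProduct_smul, smul_dotProduct, hone, h1u, hu1,
      smul_eq_mul]
    ring
  have hvQ : v ⬝ᵥ Q *ᵥ v = u ⬝ᵥ Q *ᵥ u := by
    have h1 : Q *ᵥ v = Q *ᵥ u := by
      rw [hv', mulVec_add, mulVec_smul, hQ1, smul_zero, add_zero]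
    have h2 : (1 : Fin (m + 1) → ℝ) ⬝ᵥ Q *ᵥ u = 0 := by
      rw [dotProduct_mulVec_comm_of_isSymm hQ, hQ1, dotProduct_zero]
    rw [h1]
    nth_rewrite 1 [hv']
    rw [add_dotProduct, smul_dotProduct, h2, smul_zero, add_zero]
  have hexp : star v ⬝ᵥ (1 + (1 - Q)) *ᵥ v = 2 * (v ⬝ᵥ v) - v ⬝ᵥ Q *ᵥ v := by
    rw [star_trivial, add_mulVec, sub_mulVec, one_mulVec, dotProduct_add, dotProduct_sub]
    ring
  rw [hexp, hvQ, hvv]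
  have hup' := hup u h1u
  have huu : 0 ≤ u ⬝ᵥ u := Finset.sum_nonneg fun i _ => mul_self_nonneg _
  rcases huu.eq_or_lt with h0 | hpos
  · have hu0 : u = 0 := dotProduct_self_eq_zero.1 h0.symm
    have hα0 : α ≠ 0 := by
      rintro h
      rw [hu0, h] at hv'
      exact hv (by simpa using hv')
    rw [hu0] at hup' ⊢
    have : 0 < α ^ 2 * ((m : ℝ) + 1) := by positivity
    simp
    positivity
  · have : 0 ≤ α ^ 2 * ((m : ℝ) + 1) := by positivity
    nlinarith

/-! ### Translation of the allocation problem into quadratic-program data. -/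

namespace DANA

theorem IsQuadraticCost.exists_pos {φ : ℝ → ℝ} (h : IsQuadraticCost φ) :
    ∃ a b : ℝ, 0 < a ∧ ∀ x, φ x = 1 / 2 * a * x ^ 2 + b * x := by
  obtain ⟨⟨m, hm, -, hs⟩, a, b, hab⟩ := h
  refine ⟨a, b, ?_, hab⟩
  -- Strong convexity at the midpoint of 0 and 1 already yields `m ≤ a`.
  have := hs (mem_univ (0 : ℝ)) (mem_univ (1 : ℝ))
    (a := 1 / 2) (b := 1 / 2) (by norm_num)
    (by norm_num) (by norm_num)
  simp only [hab, smul_eq_mul] at this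
  norm_num at this
  linarith

theorem iteratedDeriv_two_quadratic {φ : ℝ → ℝ} {a b : ℝ}
    (h : ∀ x, φ x = 1 / 2 * a * x ^ 2 + b * x) (x : ℝ) : iteratedDeriv 2 φ x = a := by
  have h1 : deriv φ = fun x => a * x + b := by
    ext y
    have : φ = fun x => 1 / 2 * a * x ^ 2 + b * x := funext h
    rw [this]
    have h2 := (((hasDerivAt_pow 2 y).const_mul (1 / 2 * a)).add ((hasDerivAt_id y).const_mul b))
    refine (h2.congr_deriv ?_).deriv
    push_cast
    ring
  rw [iteratedDeriv_succ, iteratedDeriv_one, h1]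
  simp

theorem hessian_eq {f : Fin n → ℝ → ℝ} {a b : Fin n → ℝ}
    (h : ∀ i x, f i x = 1 / 2 * a i * x ^ 2 + b i * x) (x : EuclideanSpace ℝ (Fin n)) :
    hessian f x = diagonal a := by
  unfold hessian
  congr 1
  ext i
  exact iteratedDeriv_two_quadratic (h i) _

/-- The condition of convergent eigenvalues bounds the quadratic form of `L H L` on the orthogonal
complement of the all-ones vector. -/
theorem ConvergentEigenvalues.exists_bounds {f : Fin n → ℝ → ℝ} {L H : Matrix (Fin n) (Fin n) ℝ}
    (h : ConvergentEigenvalues f L) (hH : ∀ x, hessian f x = H) :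
    ∃ ε : ℝ, ε < 1 ∧ ∀ v : Fin n → ℝ, 1 ⬝ᵥ v = 0 →
      (1 - ε) * (v ⬝ᵥ v) ≤ v ⬝ᵥ (L * H * L) *ᵥ v ∧
      v ⬝ᵥ (L * H * L) *ᵥ v ≤ (1 + ε) * (v ⬝ᵥ v) := by
  obtain ⟨ε, hε, hb⟩ := h
  refine ⟨ε, hε, fun v hv => ?_⟩
  obtain ⟨x, hx, hxx⟩ := exists_coordT_projJ_mulVec hv
  obtain ⟨h1, h2⟩ := hb 0
  have hM : x ⬝ᵥ reducedHessian f L 0 *ᵥ x = v ⬝ᵥ (L * H * L) *ᵥ v := by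
    have e : reducedHessian f L 0 =
        (coordT n * (projJ n)ᵀ)ᵀ * ((L * H * L) * (coordT n * (projJ n)ᵀ)) := by
      simp only [reducedHessian, hH, transpose_mul, transpose_transpose, Matrix.mul_assoc]
    rw [e, ← mulVec_mulVec, ← mulVec_mulVec, hx, dotProduct_mulVec, vecMul_transpose, hx]
  have h1' := h1.dotProduct_mulVec_nonneg x
  have h2' := h2.dotProduct_mulVec_nonneg x
  simp only [star_trivial, sub_mulVec, neg_mulVec, smul_mulVec, one_mulVec, dotProduct_sub,
    dotProduct_neg, dotProduct_smul, smul_eq_mul, hM, hxx] at h1' h2'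
  constructor <;> linarith

/-- The matrix of the box constraints. -/
def boxMatrix (L : Matrix (Fin n) (Fin n) ℝ) : Matrix (Fin n ⊕ Fin n) (Fin n) ℝ :=
  fromRows (-L) L

/-- The constant term of the box constraints. -/
def boxOffset (x0 xlo xhi : EuclideanSpace ℝ (Fin n)) : Fin n ⊕ Fin n → ℝ :=
  Sum.elim (fun i => xlo i - x0 i) (fun i => x0 i - xhi i)

/-- The linear term of the reduced cost. -/
def linearTerm (L : Matrix (Fin n) (Fin n) ℝ) (a b : Fin n → ℝ) (x0 : EuclideanSpace ℝ (Fin n)) :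
    Fin n → ℝ :=
  L *ᵥ fun i => a i * x0 i + b i

theorem alloc_apply (L : Matrix (Fin n) (Fin n) ℝ) (x0 z : EuclideanSpace ℝ (Fin n)) (i : Fin n) :
    alloc L x0 z i = x0 i + (L *ᵥ z.ofLp) i := by
  simp [alloc, toLpLin_apply]

theorem boxConstraint_ofLp (L : Matrix (Fin n) (Fin n) ℝ)
    (x0 xlo xhi z : EuclideanSpace ℝ (Fin n)) :
    (boxConstraint L x0 xlo xhi z).ofLp = boxOffset x0 xlo xhi + boxMatrix L *ᵥ z.ofLp := by
  ext k
  rcases k with i | i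
  · simp only [boxConstraint, alloc_apply, boxOffset, boxMatrix, fromRows_mulVec, neg_mulVec,
      Pi.add_apply, Sum.elim_inl, Pi.neg_apply]
    ring
  · simp only [boxConstraint, alloc_apply, boxOffset, boxMatrix, fromRows_mulVec, neg_mulVec,
      Pi.add_apply, Sum.elim_inr]
    ring

theorem reducedCost_eq {f : Fin n → ℝ → ℝ} {a b : Fin n → ℝ}
    (h : ∀ i x, f i x = 1 / 2 * a i * x ^ 2 + b i * x) {L : Matrix (Fin n) (Fin n) ℝ}
    (hL : Lᵀ = L) (x0 z : EuclideanSpace ℝ (Fin n)) :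
    reducedCost f L x0 z =
      quadCost (L * diagonal a * L) (linearTerm L a b x0) z.ofLp + ∑ i, f i (x0 i) := by
  have h1 : z.ofLp ⬝ᵥ (L * diagonal a * L) *ᵥ z.ofLp =
      (L *ᵥ z.ofLp) ⬝ᵥ fun i => a i * (L *ᵥ z.ofLp) i := by
    rw [← mulVec_mulVec, ← mulVec_mulVec, dotProduct_mulVec, ← mulVec_transpose, hL]
    simp [dotProduct, mulVec_diagonal]
  have h2 : linearTerm L a b x0 ⬝ᵥ z.ofLp = (fun i => a i * x0 i + b i) ⬝ᵥ L *ᵥ z.ofLp := by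
    rw [dotProduct_mulVec, ← mulVec_transpose, hL, linearTerm]
  rw [quadCost, h1, h2]
  simp only [reducedCost, alloc_apply, h, dotProduct, Finset.mul_sum, ← Finset.sum_add_distrib]
  exact Finset.sum_congr rfl fun i _ => by ring

theorem lagrangian_eq {f : Fin n → ℝ → ℝ} {a b : Fin n → ℝ}
    (h : ∀ i x, f i x = 1 / 2 * a i * x ^ 2 + b i * x) {L : Matrix (Fin n) (Fin n) ℝ}
    (hL : Lᵀ = L) (x0 xlo xhi z : EuclideanSpace ℝ (Fin n))
    (lam : EuclideanSpace ℝ (Fin n ⊕ Fin n)) :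
    lagrangian f L x0 xlo xhi z lam =
      quadCost (L * diagonal a * L) (linearTerm L a b x0) z.ofLp + ∑ i, f i (x0 i) +
        lam.ofLp ⬝ᵥ (boxOffset x0 xlo xhi + boxMatrix L *ᵥ z.ofLp) := by
  rw [lagrangian, reducedCost_eq h hL, ← boxConstraint_ofLp]
  rfl

/-- The Lagrangian is exactly quadratic in `z`, so the remainder after the linear term is half the
form of `Q`, which is O(‖y‖²). -/
theorem gradient_lagrangian {f : Fin n → ℝ → ℝ} {a b : Fin n → ℝ}
    (h : ∀ i x, f i x = 1 / 2 * a i * x ^ 2 + b i * x) {L : Matrix (Fin n) (Fin n) ℝ}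
    (hL : Lᵀ = L) (x0 xlo xhi z : EuclideanSpace ℝ (Fin n))
    (lam : EuclideanSpace ℝ (Fin n ⊕ Fin n)) :
    gradient (fun y => lagrangian f L x0 xlo xhi y lam) z =
      WithLp.toLp 2 ((L * diagonal a * L) *ᵥ z.ofLp + linearTerm L a b x0 +
        (boxMatrix L)ᵀ *ᵥ lam.ofLp) := by
  set Q := L * diagonal a * L with hQ
  have hQt : Qᵀ = Q := by simp [hQ, hL, Matrix.mul_assoc]
  refine HasGradientAt.gradient (hasGradientAt_iff_isLittleO_nhds_zero.2 ?_)
  have hrem : ∀ y : EuclideanSpace ℝ (Fin n),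
      lagrangian f L x0 xlo xhi (z + y) lam - lagrangian f L x0 xlo xhi z lam -
        inner ℝ (WithLp.toLp 2 (Q *ᵥ z.ofLp + linearTerm L a b x0 +
          (boxMatrix L)ᵀ *ᵥ lam.ofLp)) y = 1 / 2 * (y.ofLp ⬝ᵥ Q *ᵥ y.ofLp) := by
    intro y
    have h1 : inner ℝ (WithLp.toLp 2 (Q *ᵥ z.ofLp + linearTerm L a b x0 +
          (boxMatrix L)ᵀ *ᵥ lam.ofLp)) y = (Q *ᵥ z.ofLp + linearTerm L a b x0 +
          (boxMatrix L)ᵀ *ᵥ lam.ofLp) ⬝ᵥ y.ofLp := by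
      rw [EuclideanSpace.inner_eq_star_dotProduct, star_trivial, dotProduct_comm]
    have h2 : lam.ofLp ⬝ᵥ boxMatrix L *ᵥ y.ofLp = ((boxMatrix L)ᵀ *ᵥ lam.ofLp) ⬝ᵥ y.ofLp := by
      rw [dotProduct_mulVec, mulVec_transpose]
    rw [h1, lagrangian_eq h hL, lagrangian_eq h hL, WithLp.ofLp_add, quadCost_add hQt, mulVec_add,
      ← add_assoc (boxOffset _ _ _), dotProduct_add _ (_ + _), h2, add_dotProduct _ (_ *ᵥ lam.ofLp)]
    ring
  simp only [hrem]
  refine Asymptotics.IsBigO.trans_isLittleO (g := fun y : EuclideanSpace ℝ (Fin n) => ‖y‖ ^ 2) ?_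
    (Asymptotics.isLittleO_norm_pow_id one_lt_two)
  set q := LinearMap.toContinuousLinearMap (toEuclideanLin Q)
  refine Asymptotics.IsBigO.of_bound ‖q‖ (.of_forall fun y => ?_)
  have h1 : y.ofLp ⬝ᵥ Q *ᵥ y.ofLp = inner ℝ y (q y) := by
    rw [EuclideanSpace.inner_eq_star_dotProduct, star_trivial, dotProduct_comm]
    rfl
  rw [h1, Real.norm_eq_abs, Real.norm_eq_abs, abs_mul, abs_of_nonneg (sq_nonneg ‖y‖)]
  have h2 := abs_real_inner_le_norm y (q y)
  have h3 := q.le_opNorm y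
  have h4 : |(1 / 2 : ℝ)| ≤ 1 := by rw [abs_of_pos] <;> norm_num
  nlinarith [norm_nonneg y, abs_nonneg (inner ℝ y (q y)), mul_le_mul_of_nonneg_left h3 (norm_nonneg y)]

end DANA
end

/-! ### Feasible differences, trajectories as flows, and the conserved sum. -/

namespace DANA

variable {n : ℕ}

theorem quadForm_diagonal_eq_sum {L : Matrix (Fin n) (Fin n) ℝ} (hL : Lᵀ = L) (a v : Fin n → ℝ) :
    v ⬝ᵥ (L * diagonal a * L) *ᵥ v = ∑ i, a i * (L *ᵥ v) i ^ 2 := by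
  rw [← mulVec_mulVec, ← mulVec_mulVec, dotProduct_mulVec, ← mulVec_transpose, hL]
  simp only [dotProduct, mulVec_diagonal]
  exact Finset.sum_congr rfl fun i _ => by ring

/-- The form sees only the two allocations, and both lie in the same box. This bounds feasible
slices although the feasible set is unbounded along the all-ones vector. -/
theorem quadForm_sub_le_of_feasible {L : Matrix (Fin n) (Fin n) ℝ} (hL : Lᵀ = L) {a : Fin n → ℝ}
    (ha : ∀ i, 0 < a i) {x0 xlo xhi : EuclideanSpace ℝ (Fin n)} {x y : Fin n → ℝ}
    (hx : ∀ k, (boxOffset x0 xlo xhi + boxMatrix L *ᵥ x) k ≤ 0)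
    (hy : ∀ k, (boxOffset x0 xlo xhi + boxMatrix L *ᵥ y) k ≤ 0) :
    (x - y) ⬝ᵥ (L * diagonal a * L) *ᵥ (x - y) ≤ ∑ i, a i * (xhi i - xlo i) ^ 2 := by
  rw [quadForm_diagonal_eq_sum hL]
  refine Finset.sum_le_sum fun i _ => mul_le_mul_of_nonneg_left ?_ (ha i).le
  have h1 := hx (Sum.inl i)
  have h2 := hx (Sum.inr i)
  have h3 := hy (Sum.inl i)
  have h4 := hy (Sum.inr i)
  simp only [boxOffset, boxMatrix, fromRows_mulVec, neg_mulVec, Pi.add_apply, Sum.elim_inl,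
    Sum.elim_inr, Pi.neg_apply] at h1 h2 h3 h4
  rw [mulVec_sub, Pi.sub_apply]
  exact sq_le_sq' (by linarith) (by linarith)

theorem boxMatrix_mulVec_one {L : Matrix (Fin n) (Fin n) ℝ} (h1 : L *ᵥ 1 = 0) :
    boxMatrix L *ᵥ 1 = 0 := by
  ext k
  rcases k with i | i <;> simp [boxMatrix, fromRows_mulVec, neg_mulVec, h1]

theorem linearTerm_dotProduct_one {L : Matrix (Fin n) (Fin n) ℝ} (hL : Lᵀ = L) (h1 : L *ᵥ 1 = 0)
    (a b : Fin n → ℝ) (x0 : EuclideanSpace ℝ (Fin n)) : linearTerm L a b x0 ⬝ᵥ 1 = 0 := by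
  rw [linearTerm, dotProduct_comm, dotProduct_mulVec_comm_of_isSymm hL, h1, dotProduct_zero]

theorem _root_.HasDerivAt.euclidean_ofLp {ι : Type*} [Fintype ι] {u : ℝ → EuclideanSpace ℝ ι}
    {u' : EuclideanSpace ℝ ι} {t : ℝ} (h : HasDerivAt u u' t) :
    HasDerivAt (fun s => (u s).ofLp) u'.ofLp t := by
  rw [hasDerivAt_pi]
  intro i
  exact (EuclideanSpace.proj (𝕜 := ℝ) i).hasFDerivAt.comp_hasDerivAt t h

theorem IsTrajectory.isPrimalDualFlow {f : Fin n → ℝ → ℝ} {a b : Fin n → ℝ}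
    (h : ∀ i x, f i x = 1 / 2 * a i * x ^ 2 + b i * x) {L : Matrix (Fin n) (Fin n) ℝ}
    (hL : Lᵀ = L) {x0 xlo xhi : EuclideanSpace ℝ (Fin n)} {q : ℕ}
    {z : ℝ → EuclideanSpace ℝ (Fin n)} {lam : ℝ → EuclideanSpace ℝ (Fin n ⊕ Fin n)}
    (ht : IsTrajectory f L x0 xlo xhi q z lam) :
    IsPrimalDualFlow (∑ p ∈ Finset.range (q + 1), (1 - L * diagonal a * L) ^ p)
      (L * diagonal a * L) (boxMatrix L) (linearTerm L a b x0) (boxOffset x0 xlo xhi)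
      (fun t => (z t).ofLp) (fun t => (lam t).ofLp) := by
  refine ⟨fun i b hb => (ht.1 b hb).1.euclidean_apply i,
    fun k b hb => (ht.1 b hb).2.euclidean_apply k, ?_⟩
  filter_upwards [(ae_restrict_iff' measurableSet_Ici).1 ht.2] with t hd ht0
  obtain ⟨h1, h2⟩ := hd ht0
  constructor
  · refine h1.euclidean_ofLp.congr_deriv ?_
    simp only [primalField, gradient_lagrangian h hL, approxInv, hessian_eq h, toLpLin_apply,
      WithLp.ofLp_neg]
  · refine h2.euclidean_ofLp.congr_deriv ?_
    simp only [dualField, boxConstraint_ofLp]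

/-- A direction orthogonal to all gradients and fixed by the weighting is conserved. -/
theorem _root_.IsPrimalDualFlow.dotProduct_eq {ι κ : Type*} [Fintype ι] [Fintype κ]
    {A Q : Matrix ι ι ℝ} {B : Matrix κ ι ℝ} {g : ι → ℝ} {c : κ → ℝ} {z : ℝ → ι → ℝ}
    {l : ℝ → κ → ℝ} (hf : IsPrimalDualFlow A Q B g c z l) {e : ι → ℝ} {r : ℝ}
    (heA : e ᵥ* A = r • e) (hQ : Qᵀ = Q) (hQe : Q *ᵥ e = 0) (hBe : B *ᵥ e = 0) (hge : g ⬝ᵥ e = 0)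
    {t : ℝ} (ht : 0 ≤ t) : e ⬝ᵥ z t = e ⬝ᵥ z 0 := by
  have := abs_sub_le_of_ae_hasDerivAt_bounded (φ := fun t => e ⬝ᵥ z t) (φ' := fun _ => 0) (C := 0)
    (fun b hb => AbsolutelyContinuousOnInterval.dotProduct
      (fun i => .const' (e i) _ _) fun i => hf.ac_primal i b hb) (by
      filter_upwards [hf.hasDerivAt] with t hd ht
      refine ⟨?_, by simp⟩
      have h1 := (hasDerivAt_const t e).dotProduct' (hd ht).1
      refine h1.congr_deriv ?_
      have h2 : e ⬝ᵥ Q *ᵥ z t = 0 := by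
        rw [dotProduct_mulVec_comm_of_isSymm hQ, hQe, dotProduct_zero]
      have h3 : e ⬝ᵥ Bᵀ *ᵥ l t = 0 := by
        rw [dotProduct_mulVec, vecMul_transpose, hBe, zero_dotProduct]
      rw [zero_dotProduct, zero_add, dotProduct_neg, dotProduct_mulVec, heA, smul_dotProduct,
        dotProduct_add, dotProduct_add, h2, h3, dotProduct_comm e g, hge]
      simp) le_rfl ht
  have h0 := abs_nonpos_iff.1 (this.trans (by simp))
  linarith

theorem one_dotProduct_eq_sum (z : Fin n → ℝ) : 1 ⬝ᵥ z = ∑ i, z i := by simp [dotProduct]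

end DANA

end

/-! ### Assembly. -/

theorem theorem3 {n : ℕ} (G : SimpleGraph (Fin n)) [DecidableRel G.Adj] (hG : G.Connected)
    (w : Fin n → Fin n → ℝ) (hw_symm : ∀ i j, w i j = w j i)
    (hw_pos : ∀ i j, G.Adj i j → 0 < w i j)
    (L : Matrix (Fin n) (Fin n) ℝ) (hL : L = DANA.weightedLaplacian G w)
    (f : Fin n → ℝ → ℝ) (hf : ∀ i, DANA.IsQuadraticCost (f i))
    (d : ℝ) (x0 xlo xhi : EuclideanSpace ℝ (Fin n)) (hx0 : ∑ i, x0 i = d)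
    (hconv : DANA.ConvergentEigenvalues f L)
    (hslater : ∃ y : EuclideanSpace ℝ (Fin n), ∀ k, DANA.boxConstraint L x0 xlo xhi y k < 0)
    (q : ℕ)
    (z : ℝ → EuclideanSpace ℝ (Fin n)) (lam : ℝ → EuclideanSpace ℝ (Fin n ⊕ Fin n))
    (htraj : DANA.IsTrajectory f L x0 xlo xhi q z lam)
    (hlam0 : ∀ k, 0 ≤ lam 0 k) :
    ∃ zs : EuclideanSpace ℝ (Fin n),
      DANA.IsOptimizer f L x0 xlo xhi zs ∧
      ∑ i, zs i = ∑ i, z 0 i ∧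
      (∀ y : EuclideanSpace ℝ (Fin n), DANA.IsOptimizer f L x0 xlo xhi y →
        ∑ i, y i = ∑ i, z 0 i → y = zs) ∧
      ∃ ls : EuclideanSpace ℝ (Fin n ⊕ Fin n),
        DANA.IsSaddlePoint f L x0 xlo xhi zs ls ∧
        Filter.Tendsto z Filter.atTop (nhds zs) ∧
        Filter.Tendsto lam Filter.atTop (nhds ls) := by
  have hLt : Lᵀ = L := hL ▸ DANA.weightedLaplacian_transpose G w hw_symm
  have hL1 : L *ᵥ 1 = 0 := hL ▸ DANA.weightedLaplacian_mulVec_one G w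
  choose a b ha hab using fun i => (hf i).exists_pos
  obtain ⟨ε, hε, hbd⟩ := hconv.exists_bounds (DANA.hessian_eq hab)
  obtain ⟨y, hy⟩ := hslater
  set Q := L * diagonal a * L with hQ
  set B := DANA.boxMatrix L with hB
  set g := DANA.linearTerm L a b x0 with hg
  set c := DANA.boxOffset x0 xlo xhi with hc
  have hP : ∀ x k, DANA.boxConstraint L x0 xlo xhi x k = (c + B *ᵥ x.ofLp) k := fun x k =>
    congrFun (DANA.boxConstraint_ofLp L x0 xlo xhi x) k
  have hfeas : ∀ x, x ∈ DANA.feasibleSet L x0 xlo xhi ↔ ∀ k, (c + B *ᵥ x.ofLp) k ≤ 0 := fun x =>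
    forall_congr' fun k => by rw [hP]
  have hcost : ∀ x, DANA.reducedCost f L x0 x = quadCost Q g x.ofLp + ∑ i, f i (x0 i) :=
    DANA.reducedCost_eq hab hLt x0
  have hQt : Qᵀ = Q := by simp [hQ, hLt, Matrix.mul_assoc]
  have hQpsd : Q.PosSemidef := by
    have := (PosSemidef.diagonal (d := a) fun i => (ha i).le).conjTranspose_mul_mul_same L
    rwa [conjTranspose_eq_transpose_of_trivial, hLt] at this
  have hQ1 : Q *ᵥ 1 = 0 := by rw [hQ, ← mulVec_mulVec, hL1, mulVec_zero]
  have hB1 : B *ᵥ 1 = 0 := DANA.boxMatrix_mulVec_one hL1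
  have hg1 : g ⬝ᵥ 1 = 0 := DANA.linearTerm_dotProduct_one hLt hL1 a b x0
  have hm : 0 < 1 - ε := by linarith
  have hn : (0 : ℝ) < (1 : Fin n → ℝ) ⬝ᵥ 1 := by
    have := hG.nonempty
    simpa [dotProduct] using Fin.pos_iff_nonempty.2 this
  have hy' : ∀ k, (c + B *ᵥ y.ofLp) k < 0 := fun k => by rw [← hP]; exact hy k
  obtain ⟨zs, hzsum, hzfeas, hzmin⟩ := exists_optimum_on_slice hn hQt hQ1 hB1 hg1 hm
    (fun v hv => (hbd v hv).1) (fun _ _ => DANA.quadForm_sub_le_of_feasible hLt ha)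
    (fun k => (hy' k).le) (1 ⬝ᵥ (z 0).ofLp)
  -- An auxiliary multiplier to start the Lyapunov argument; the limit `ls` may be a different one.
  obtain ⟨ls₀, hk₀⟩ := exists_isKKT hQpsd hzfeas hzmin hy'
  have hflow := htraj.isPrimalDualFlow hab hLt
  have hA := posDef_sum_range_pow (R := 1 - Q) (by simp [hQt])
    (posDef_two_sub hQt hQ1 hε fun v hv => (hbd v hv).2) q
  have hA1 := vecMul_sum_range_pow (R := 1 - Q) (e := 1) (by
    rw [vecMul_sub, vecMul_one, ← mulVec_transpose, hQt, hQ1, sub_zero]) q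
  obtain ⟨hz, ls, hk, hl⟩ := hflow.tendsto_isKKT hA hlam0 hk₀ hm fun t ht => (hbd _ (by
    rw [dotProduct_sub, hflow.dotProduct_eq hA1 hQt hQ1 hB1 hg1 ht, hzsum, sub_self])).1
  have hlag : ∀ x (μ : EuclideanSpace ℝ (Fin n ⊕ Fin n)), DANA.lagrangian f L x0 xlo xhi x μ =
      quadCost Q g x.ofLp + ∑ i, f i (x0 i) + μ.ofLp ⬝ᵥ (c + B *ᵥ x.ofLp) :=
    fun x μ => DANA.lagrangian_eq hab hLt x0 xlo xhi x μ
  refine ⟨WithLp.toLp 2 zs, ⟨(hfeas _).2 hzfeas, fun x hx => ?_⟩, ?_, ?_, WithLp.toLp 2 ls,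
    ⟨hk.nonneg, fun μ hμ => ?_, fun x => ?_⟩, ?_, ?_⟩
  · rw [hcost, hcost]
    linarith [hzmin x.ofLp ((hfeas x).1 hx)]
  · simpa [dotProduct] using hzsum
  · intro x hx hxsum
    -- The exact expansion of the Lagrangian makes the form of `Q` at the difference of two
    -- optimizers nonpositive; on a common slice coercivity makes that difference zero.
    have h1 := hk.lagrangian_eq hQt x.ofLp
    have hxf := (hfeas x).1 hx.1
    have h2 := hx.2 (WithLp.toLp 2 zs) ((hfeas _).2 hzfeas)
    rw [hcost, hcost] at h2
    have h3 : ls ⬝ᵥ (c + B *ᵥ x.ofLp) ≤ 0 := Finset.sum_nonpos fun k _ =>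
      mul_nonpos_of_nonneg_of_nonpos (hk.nonneg k) (hxf k)
    have h4 := (hbd (x.ofLp - zs) (by
      rw [dotProduct_sub, hzsum, DANA.one_dotProduct_eq_sum, DANA.one_dotProduct_eq_sum, hxsum,
        sub_self])).1
    have h5 : 0 ≤ (x.ofLp - zs) ⬝ᵥ (x.ofLp - zs) :=
      Finset.sum_nonneg fun i _ => mul_self_nonneg _
    have h6 : (x.ofLp - zs) ⬝ᵥ (x.ofLp - zs) = 0 := by
      refine le_antisymm ?_ h5
      by_contra! h7
      nlinarith [mul_pos hm h7]
    have h7 := sub_eq_zero.1 (dotProduct_self_eq_zero.1 h6)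
    rw [← h7]
  · rw [hlag, hlag, hk.slack]
    have : μ.ofLp ⬝ᵥ (c + B *ᵥ zs) ≤ 0 := Finset.sum_nonpos fun k _ =>
      mul_nonpos_of_nonneg_of_nonpos (hμ k) (hk.feasible k)
    linarith
  · rw [hlag, hlag, hk.slack]
    have h1 := hk.lagrangian_eq hQt x.ofLp
    have h2 := hQpsd.dotProduct_mulVec_nonneg (x.ofLp - zs)
    rw [star_trivial] at h2
    linarith
  · exact ((PiLp.continuous_toLp 2 _).tendsto zs).comp hz
  · exact ((PiLp.continuous_toLp 2 _).tendsto ls).comp hl
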